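/- Let $n\ge 3$. Let $D_n$ be the group of all permutations $\pi$ of $\{\pm1,\dots,\pm n\}$ such that $\pi(-a)=-\pi(a)$ for every $a$ and such that the number of positive $a$ with $\pi(a)<0$ is even. Its Coxeter generators are $(a,a+1)(-a,-(a+1))$ for $1\le a\le n-1$, together with $(1,-2)(-1,2)$; its reflections are the conjugates of these generators, and $\ell(w)$ is the least number of Coxeter generators whose product is $w$. In the (strong) Bruhat order, $u\le v$ means that there is a chain $u=w_k,w_{k-1},\dots,w_0=v$ with $k\ge 0$ in which, for every $i$, $w_{i+1}=t\,w_i$ for some reflection $t$ and $\ell(w_{i+1})<\ell(w_i)$. Let $H(D_n)$ be the Hasse diagram of this order, the undirected graph with vertex set $D_n$ in which two elements are adjacent if and only if one of them covers the other. Then the maximum degree of a vertex of $H(D_n)$ is $$d_{\max}(H(D_n))=\left\lfloor \frac{n^2}{2}\right\rfloor+n-1 .$$ Moreover, if $n\ge 4$ and $m=\lfloor n/2\rfloor$, this maximum is attained at the element $\pi\in D_n$ with window $[\pi(1),\dots,\pi(n)]=[\varepsilon,2,\dots,m,-n,-(n-1),\dots,-(m+1)]$, where $\varepsilon=(-1)^{n-m}$.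 -/

import Mathlib

/-! ### Bruhat order of a group with a distinguished set of generators -/

section Bruhat

variable {W : Type*} [Group W]

/-- The length of `w` with respect to `S`: the least `k` such that `w` is a product of `k`
elements of `S`. -/
noncomputable def wordLength (S : Set W) (w : W) : ℕ :=
  sInf {k : ℕ | ∃ l : List W, (∀ s ∈ l, s ∈ S) ∧ l.prod = w ∧ l.length = k}

/-- The reflections: all conjugates of elements of `S`. -/
def reflections (S : Set W) : Set W :=
  {t | ∃ w : W, ∃ s ∈ S, t = w * s * w⁻¹}

/-- `u → v`: `u = t * v` for a reflection `t`, and `u` is shorter than `v`. -/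
def BruhatStep (S : Set W) (u v : W) : Prop :=
  (∃ t ∈ reflections S, u = t * v) ∧ wordLength S u < wordLength S v

theorem wordLength_le_of_chain {S : Set W} {u v : W}
    (h : Relation.ReflTransGen (BruhatStep S) u v) : u = v ∨ wordLength S u < wordLength S v := by
  induction h with
  | refl => exact Or.inl rfl
  | tail _ h2 ih =>
    rcases ih with rfl | ih
    · exact Or.inr h2.2
    · exact Or.inr (ih.trans h2.2)

/-- The (strong) Bruhat order: `u ≤ v` when there is a chain `u → ⋯ → v`. -/
@[reducible] def bruhatOrder (S : Set W) : PartialOrder W where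
  le := Relation.ReflTransGen (BruhatStep S)
  le_refl _ := Relation.ReflTransGen.refl
  le_trans _ _ _ h1 h2 := h1.trans h2
  le_antisymm u v h1 h2 := by
    rcases wordLength_le_of_chain h1 with h | h
    · exact h
    · rcases wordLength_le_of_chain h2 with h' | h'
      · exact h'.symm
      · exact absurd (h.trans h') (lt_irrefl _)

/-- The Hasse diagram of the Bruhat order, as an undirected graph: two elements are adjacent
when one of them covers the other. -/
def bruhatHasse (S : Set W) : SimpleGraph W :=
  @SimpleGraph.hasse W (bruhatOrder S).toPreorder

noncomputable instance (S : Set W) : DecidableRel (bruhatHasse S).Adj :=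
  Classical.decRel _

end Bruhat

/-! ### The even hyperoctahedral group -/

/-- The set `{±1, …, ±n}`. -/
abbrev SignedIndex (n : ℕ) : Type :=
  {a : ℤ // a ∈ (Finset.Icc (-(n : ℤ)) (n : ℤ)).erase 0}

instance (n : ℕ) : Neg (SignedIndex n) where
  neg a := ⟨-a.1, by
    have h := a.2
    simp only [Finset.mem_erase, Finset.mem_Icc] at h ⊢
    omega⟩

@[simp] theorem SignedIndex.coe_neg {n : ℕ} (a : SignedIndex n) : (-a).1 = -a.1 := rfl

theorem SignedIndex.ne_zero {n : ℕ} (a : SignedIndex n) : a.1 ≠ 0 :=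
  (Finset.mem_erase.mp a.2).1

theorem SignedIndex.neg_neg {n : ℕ} (a : SignedIndex n) : - -a = a :=
  Subtype.ext (by simp)

/-- The hyperoctahedral group `B_n`: the permutations `π` of `{±1, …, ±n}` with
`π (-a) = - π a`. -/
def hyperoctahedralGroup (n : ℕ) : Subgroup (Equiv.Perm (SignedIndex n)) where
  carrier := {π | ∀ a, π (-a) = -π a}
  mul_mem' {π σ} hπ hσ a := by
    change π (σ (-a)) = -π (σ a)
    rw [hσ a, hπ (σ a)]
  one_mem' _ := rfl
  inv_mem' {π} hπ a := by
    apply π.injective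
    rw [hπ (π⁻¹ a)]
    simp

/-- The positive elements with negative image. -/
noncomputable def negSet {n : ℕ} (π : Equiv.Perm (SignedIndex n)) : Finset (SignedIndex n) :=
  Finset.univ.filter fun a => 0 < a.1 ∧ (π a).1 < 0

theorem neg_one_pow_card_negSet {n : ℕ} (π : Equiv.Perm (SignedIndex n)) :
    (-1 : ℤ) ^ (negSet π).card =
      ∏ a ∈ Finset.univ.filter (fun a : SignedIndex n => 0 < a.1), (π a).1.sign := by
  rw [negSet, ← Finset.filter_filter, Finset.card_filter, ← Finset.prod_pow_eq_pow_sum]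
  refine Finset.prod_congr rfl fun a _ => ?_
  rcases lt_or_gt_of_ne (π a).ne_zero with h | h
  · simp [h, Int.sign_eq_neg_one_of_neg h]
  · simp [h.not_gt, Int.sign_eq_one_of_pos h]

theorem neg_one_pow_card_negSet_mul {n : ℕ} {π σ : Equiv.Perm (SignedIndex n)}
    (hπ : π ∈ hyperoctahedralGroup n) (hσ : σ ∈ hyperoctahedralGroup n) :
    (-1 : ℤ) ^ (negSet (π * σ)).card = (-1) ^ (negSet π).card * (-1) ^ (negSet σ).card := by
  have hπ' : ∀ a, π (-a) = -π a := hπ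
  have hσ' : ∀ a, σ (-a) = -σ a := hσ
  let f : SignedIndex n → SignedIndex n := fun a => if 0 < (σ a).1 then σ a else -σ a
  have hf : ∀ a, (π (σ a)).1.sign = (π (f a)).1.sign * (σ a).1.sign := by
    intro a
    by_cases h : 0 < (σ a).1
    · simp [f, h, Int.sign_eq_one_of_pos h]
    · have h2 : (σ a).1 < 0 := lt_of_le_of_ne (not_lt.mp h) (σ a).ne_zero
      simp [f, h, hπ', Int.sign_eq_neg_one_of_neg h2]
  rw [neg_one_pow_card_negSet, neg_one_pow_card_negSet, neg_one_pow_card_negSet]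
  simp only [Equiv.Perm.mul_apply, hf]
  rw [Finset.prod_mul_distrib]
  congr 1
  have hmem : ∀ a ∈ Finset.univ.filter (fun a : SignedIndex n => 0 < a.1),
      f a ∈ Finset.univ.filter (fun a : SignedIndex n => 0 < a.1) := by
    intro a _
    by_cases h : 0 < (σ a).1
    · simp [f, h]
    · have h2 : (σ a).1 < 0 := lt_of_le_of_ne (not_lt.mp h) (σ a).ne_zero
      simp [f, h, h2]
  have hinj : Set.InjOn f (Finset.univ.filter (fun a : SignedIndex n => 0 < a.1)) := by
    intro a ha b hb hab
    simp only [Finset.coe_filter, Finset.mem_univ, true_and, Set.mem_ofPred_eq] at ha hb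
    have key : σ a = σ b ∨ σ a = σ (-b) := by
      rw [hσ']
      simp only [f] at hab
      split_ifs at hab
      · exact Or.inl hab
      · exact Or.inr hab
      · exact Or.inr (by rw [← hab, SignedIndex.neg_neg])
      · exact Or.inl (by rw [← SignedIndex.neg_neg (σ a), hab, SignedIndex.neg_neg])
    rcases key with h | h
    · exact σ.injective h
    · have h3 := congrArg Subtype.val (σ.injective h)
      rw [SignedIndex.coe_neg] at h3
      omega
  exact Finset.prod_nbij f hmem hinj
    (Finset.surjOn_of_injOn_of_card_le f hmem hinj le_rfl) (fun _ _ => rfl)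

/-- The even hyperoctahedral group `D_n`: the elements of `B_n` for which an even number of
positive elements have negative image. -/
def evenHyperoctahedralGroup (n : ℕ) : Subgroup (Equiv.Perm (SignedIndex n)) where
  carrier := {π | π ∈ hyperoctahedralGroup n ∧ Even (negSet π).card}
  mul_mem' {π σ} hπ hσ := by
    refine ⟨mul_mem hπ.1 hσ.1, ?_⟩
    rw [← neg_one_pow_eq_one_iff_even (R := ℤ) (by norm_num),
      neg_one_pow_card_negSet_mul hπ.1 hσ.1, hπ.2.neg_one_pow, hσ.2.neg_one_pow, one_mul]
  one_mem' := by
    refine ⟨one_mem _, ?_⟩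
    have h : negSet (1 : Equiv.Perm (SignedIndex n)) = ∅ := by
      refine Finset.filter_eq_empty_iff.mpr fun a _ ha => ?_
      exact lt_asymm ha.1 ha.2
    simp [h]
  inv_mem' {π} hπ := by
    refine ⟨inv_mem hπ.1, ?_⟩
    have h := neg_one_pow_card_negSet_mul hπ.1 (inv_mem hπ.1)
    have h1 : negSet (1 : Equiv.Perm (SignedIndex n)) = ∅ := by
      refine Finset.filter_eq_empty_iff.mpr fun a _ ha => ?_
      exact lt_asymm ha.1 ha.2
    rw [mul_inv_cancel, h1, hπ.2.neg_one_pow, one_mul] at h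
    rw [← neg_one_pow_eq_one_iff_even (R := ℤ) (by norm_num), ← h]
    simp

noncomputable instance (n : ℕ) : Fintype (evenHyperoctahedralGroup n) :=
  Fintype.ofFinite _

/-- The Coxeter generators of `D_n`: `(a, a+1)(-a, -(a+1))` for `1 ≤ a < n`, together with
`(1, -2)(-1, 2)`. -/
def evenHyperoctahedralGenerators (n : ℕ) : Set (evenHyperoctahedralGroup n) :=
  {s | ∃ a b : SignedIndex n,
    ((0 < a.1 ∧ b.1 = a.1 + 1) ∨ (a.1 = 1 ∧ b.1 = -2)) ∧
      s.1 = Equiv.swap a b * Equiv.swap (-a) (-b)}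

/-- The Hasse diagram `H(D_n)` of the Bruhat order of `D_n`. -/
noncomputable abbrev hasseD (n : ℕ) : SimpleGraph (evenHyperoctahedralGroup n) :=
  bruhatHasse (evenHyperoctahedralGenerators n)

/-! ### The reflections of `D_n` -/

namespace SignedIndex

variable {n : ℕ}

/-! View `w` as the centrally symmetric set of points `(k, w k)`. For `n ≥ 3` the reflections are
exactly the signed transpositions, and right multiplication by one exchanges the values at `i`, `j`
and at `-i`, `-j`. Four times the length is the number of ordered inverted pairs of non-antipodal
positions (`four_mul_wordLength`). It follows that `w` and `w * t` are adjacent exactly when `i` and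
`j` see each other: the open rectangle spanned by their points is empty, the points at `-i` and `-j`
being ignored (`bruhat_covBy_iff`, `hasseD_adj_iff`). So the degree counts visible pairs up to
exchange and antipode.

For the upper bound the group is forgotten: an induction over symmetric point sets with `n`
antipodal orbits shows that at most `2n² + 4n - 4` ordered pairs are visible (`visiblePairs_bound`).
Deleting orbits never destroys visibility among the rest, so only pairs meeting the deleted orbits
must be paid for. Deleting `±a, ±q` is affordable when the number of positions seen by both, plus
the links between the two orbits, is at most 4 plus the number seen by neither.

Let `a` be the leftmost position and `b`, `c` the positions of the next larger and next smaller
value; up to a sign change of `w`, `c` is left of `b`. A position seen by both `a` and `b` cannot be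
hidden by `b`, by `c` or by another such position, and this leaves at most three (`card_le_or`).
Three occur only when `c`, `-c` and one higher `d`, or `c` and two antipodal higher `d`, `-d`, are
seen by both. In these cases the partner `b` is replaced by `c` or by `d`, or else `a` sees at most
half of the configuration and its orbit is deleted alone. If `a` has no smaller or no larger value
beside it, two common positions is the maximum. Small configurations are settled by the trivial
bound.

For the lower bound, the extremal window has an increasing block of low positions and an increasing
block of high positions with very negative values. Every signed low position sees every high one,
which gives `2m(n - m)` pairs; neighbours inside the blocks and the pair `(-1, 2)` give `n - 1`
more. -/

theorem eq_iff {a b : SignedIndex n} : a = b ↔ a.1 = b.1 := Subtype.ext_iff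

theorem bounds (a : SignedIndex n) : a.1 ≠ 0 ∧ -(n : ℤ) ≤ a.1 ∧ a.1 ≤ n := by
  have h := a.2
  simp only [Finset.mem_erase, Finset.mem_Icc] at h
  exact h

/-- The element of `{±1, …, ±n}` with a given nonzero value. -/
def mk' (x : ℤ) (h0 : x ≠ 0) (h1 : -(n : ℤ) ≤ x) (h2 : x ≤ n) : SignedIndex n :=
  ⟨x, by simp only [Finset.mem_erase, Finset.mem_Icc]; exact ⟨h0, h1, h2⟩⟩

@[simp] theorem coe_mk' (x : ℤ) (h0 : x ≠ 0) (h1 : -(n : ℤ) ≤ x) (h2 : x ≤ n) :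
    (mk' x h0 h1 h2 : SignedIndex n).1 = x := rfl

end SignedIndex

section SignedSwap

variable {n : ℕ}

/-- The signed transposition `(i, j)(-i, -j)`. -/
def signedSwap (i j : SignedIndex n) : Equiv.Perm (SignedIndex n) :=
  Equiv.swap i j * Equiv.swap (-i) (-j)

theorem signedSwap_apply {i j : SignedIndex n} (_h : i.1 ≠ j.1) (h' : i.1 ≠ -j.1)
    (k : SignedIndex n) :
    (signedSwap i j k).1 = if k.1 = i.1 then j.1 else if k.1 = j.1 then i.1
      else if k.1 = -i.1 then -j.1 else if k.1 = -j.1 then -i.1 else k.1 := by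
  have hi := i.ne_zero
  have hj := j.ne_zero
  simp only [signedSwap, Equiv.Perm.mul_apply, Equiv.swap_apply_def, SignedIndex.eq_iff,
    SignedIndex.coe_neg, apply_ite Subtype.val]
  split_ifs <;> omega

theorem signedSwap_neg {i j : SignedIndex n} (h : i.1 ≠ j.1) (h' : i.1 ≠ -j.1)
    (k : SignedIndex n) : signedSwap i j (-k) = -signedSwap i j k := by
  have hi := i.ne_zero
  have hj := j.ne_zero
  rw [SignedIndex.eq_iff, SignedIndex.coe_neg, signedSwap_apply h h', signedSwap_apply h h']
  simp only [SignedIndex.coe_neg]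
  split_ifs <;> omega

theorem even_card_negSet_signedSwap {i j : SignedIndex n} (h : i.1 ≠ j.1) (h' : i.1 ≠ -j.1) :
    Even (negSet (signedSwap i j)).card := by
  have hi := i.ne_zero
  have hj := j.ne_zero
  have key : ∀ a b : SignedIndex n, a.1 ≠ b.1 →
      (∀ k, k ∈ negSet (signedSwap i j) ↔ k.1 = a.1 ∨ k.1 = b.1) →
      Even (negSet (signedSwap i j)).card := by
    intro a b hab hk
    have : negSet (signedSwap i j) = {a, b} := by
      ext k
      rw [hk, Finset.mem_insert, Finset.mem_singleton, SignedIndex.eq_iff, SignedIndex.eq_iff]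
    rw [this, Finset.card_pair (fun e => hab (congrArg Subtype.val e))]
    exact even_two
  rcases lt_or_gt_of_ne hi with hi' | hi' <;> rcases lt_or_gt_of_ne hj with hj' | hj'
  on_goal 2 => refine key (-i) j (by simp only [SignedIndex.coe_neg]; omega) fun k => ?_
  on_goal 3 => refine key i (-j) (by simp only [SignedIndex.coe_neg]; omega) fun k => ?_
  on_goal 1 => 
    have : negSet (signedSwap i j) = ∅ := by
      refine Finset.filter_eq_empty_iff.mpr fun k _ hk => ?_
      rw [signedSwap_apply h h'] at hk
      split_ifs at hk <;> omega
    simp [this]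
  on_goal 3 => 
    have : negSet (signedSwap i j) = ∅ := by
      refine Finset.filter_eq_empty_iff.mpr fun k _ hk => ?_
      rw [signedSwap_apply h h'] at hk
      split_ifs at hk <;> omega
    simp [this]
  all_goals
    simp only [negSet, Finset.mem_filter, Finset.mem_univ, true_and, signedSwap_apply h h',
      SignedIndex.coe_neg]
    split_ifs <;> omega

theorem signedSwap_mem {i j : SignedIndex n} (h : i.1 ≠ j.1) (h' : i.1 ≠ -j.1) :
    signedSwap i j ∈ evenHyperoctahedralGroup n :=
  ⟨signedSwap_neg h h', even_card_negSet_signedSwap h h'⟩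

/-- The reflection of `D_n` given by the signed transposition `(i, j)(-i, -j)`. -/
def signedReflection (i j : SignedIndex n) (h : i.1 ≠ j.1) (h' : i.1 ≠ -j.1) :
    evenHyperoctahedralGroup n :=
  ⟨signedSwap i j, signedSwap_mem h h'⟩

theorem evenHyperoctahedral_ext {v w : evenHyperoctahedralGroup n}
    (h : ∀ k, (v.1 k).1 = (w.1 k).1) : v = w :=
  Subtype.ext (Equiv.ext fun k => Subtype.ext (h k))

theorem evenHyperoctahedral_neg (w : evenHyperoctahedralGroup n) (k : SignedIndex n) :
    w.1 (-k) = -w.1 k := w.2.1 k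

theorem coe_apply_neg (w : evenHyperoctahedralGroup n) (k : SignedIndex n) :
    (w.1 (-k)).1 = -(w.1 k).1 := by
  rw [evenHyperoctahedral_neg, SignedIndex.coe_neg]

theorem coe_apply_eq_iff (w : evenHyperoctahedralGroup n) (i j : SignedIndex n) :
    (w.1 i).1 = (w.1 j).1 ↔ i.1 = j.1 := by
  rw [← SignedIndex.eq_iff, w.1.injective.eq_iff, SignedIndex.eq_iff]

theorem coe_apply_eq_neg_iff (w : evenHyperoctahedralGroup n) (i j : SignedIndex n) :
    (w.1 i).1 = -(w.1 j).1 ↔ i.1 = -j.1 := by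
  rw [← coe_apply_neg, coe_apply_eq_iff, SignedIndex.coe_neg]

theorem coe_apply_congr (w : evenHyperoctahedralGroup n) {i j : SignedIndex n}
    (h : i.1 = j.1) : (w.1 i).1 = (w.1 j).1 := (coe_apply_eq_iff w i j).2 h

theorem coe_apply_congr_neg (w : evenHyperoctahedralGroup n) {i j : SignedIndex n}
    (h : i.1 = -j.1) : (w.1 i).1 = -(w.1 j).1 := (coe_apply_eq_neg_iff w i j).2 h

theorem mul_signedReflection_apply (w : evenHyperoctahedralGroup n) {i j : SignedIndex n}
    (h : i.1 ≠ j.1) (h' : i.1 ≠ -j.1) (k : SignedIndex n) :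
    ((w * signedReflection i j h h').1 k).1 =
      if k.1 = i.1 then (w.1 j).1 else if k.1 = j.1 then (w.1 i).1
      else if k.1 = -i.1 then -(w.1 j).1 else if k.1 = -j.1 then -(w.1 i).1 else (w.1 k).1 := by
  have hs := signedSwap_apply h h' k
  change (w.1 (signedSwap i j k)).1 = _
  split_ifs at hs ⊢
  · exact coe_apply_congr w hs
  · exact coe_apply_congr w hs
  · exact coe_apply_congr_neg w hs
  · exact coe_apply_congr_neg w hs
  · exact coe_apply_congr w hs

theorem signedReflection_comm {i j : SignedIndex n} (h : i.1 ≠ j.1) (h' : i.1 ≠ -j.1) :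
    signedReflection i j h h' = signedReflection j i h.symm (by omega) := by
  refine evenHyperoctahedral_ext fun k => ?_
  simp only [signedReflection, signedSwap_apply h h', signedSwap_apply h.symm (by omega)]
  split_ifs <;> omega

theorem signedReflection_mul_self {i j : SignedIndex n} (h : i.1 ≠ j.1) (h' : i.1 ≠ -j.1) :
    signedReflection i j h h' * signedReflection i j h h' = 1 := by
  have hi := i.ne_zero
  have hj := j.ne_zero
  refine evenHyperoctahedral_ext fun k => ?_
  rw [mul_signedReflection_apply]
  simp only [signedReflection, signedSwap_apply h h', OneMemClass.coe_one, Equiv.Perm.one_apply]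
  split_ifs <;> omega

theorem mul_signedReflection_cancel (w : evenHyperoctahedralGroup n) {i j : SignedIndex n}
    (h : i.1 ≠ j.1) (h' : i.1 ≠ -j.1) :
    w * signedReflection i j h h' * signedReflection i j h h' = w := by
  rw [mul_assoc, signedReflection_mul_self, mul_one]

/-- Conjugation carries positions to values. It turns the left multiplications in the definition of
the order into right multiplications, which exchange two positions. -/
theorem signedReflection_conj (w : evenHyperoctahedralGroup n) {i j : SignedIndex n}
    (h : i.1 ≠ j.1) (h' : i.1 ≠ -j.1) :
    w * signedReflection i j h h' =
      signedReflection (w.1 i) (w.1 j) (by rwa [Ne, coe_apply_eq_iff])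
        (by rwa [Ne, coe_apply_eq_neg_iff]) * w := by
  refine evenHyperoctahedral_ext fun k => ?_
  rw [mul_signedReflection_apply]
  change _ = (signedSwap (w.1 i) (w.1 j) (w.1 k)).1
  rw [signedSwap_apply (by rwa [Ne, coe_apply_eq_iff]) (by rwa [Ne, coe_apply_eq_neg_iff])]
  simp only [coe_apply_eq_iff, coe_apply_eq_neg_iff]

theorem mem_generators_iff {s : evenHyperoctahedralGroup n} :
    s ∈ evenHyperoctahedralGenerators n ↔ ∃ (i j : SignedIndex n) (h : i.1 ≠ j.1)
      (h' : i.1 ≠ -j.1), ((0 < i.1 ∧ j.1 = i.1 + 1) ∨ (i.1 = 1 ∧ j.1 = -2)) ∧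
        s = signedReflection i j h h' := by
  constructor
  · rintro ⟨i, j, h, hs⟩
    exact ⟨i, j, by omega, by omega, h, Subtype.ext hs⟩
  · rintro ⟨i, j, _, _, h, rfl⟩
    exact ⟨i, j, h, rfl⟩

theorem signedReflection_mem_reflections_of_conj (w : evenHyperoctahedralGroup n)
    {i j k l : SignedIndex n} {h : i.1 ≠ j.1} {h' : i.1 ≠ -j.1} {h₁ : k.1 ≠ l.1}
    {h₁' : k.1 ≠ -l.1} (hk : (w.1 i).1 = k.1) (hl : (w.1 j).1 = l.1)
    (hm : signedReflection i j h h' ∈ reflections (evenHyperoctahedralGenerators n)) :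
    signedReflection k l h₁ h₁' ∈ reflections (evenHyperoctahedralGenerators n) := by
  obtain ⟨v, s, hs, e⟩ := hm
  obtain rfl := Subtype.ext hk
  obtain rfl := Subtype.ext hl
  refine ⟨w * v, s, hs, ?_⟩
  rw [eq_mul_inv_iff_mul_eq, ← mul_assoc, ← signedReflection_conj w h h', e]
  group

/-- All signed transpositions are conjugate to the one exchanging 1 and 2. A third coordinate is
needed to reverse the sign of 2 alone while staying in the even group and fixing 1. -/
theorem signedReflection_mem_reflections (hn : 3 ≤ n) {i j : SignedIndex n} (h : i.1 ≠ j.1)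
    (h' : i.1 ≠ -j.1) :
    signedReflection i j h h' ∈ reflections (evenHyperoctahedralGenerators n) := by
  obtain ⟨e1, he1⟩ : ∃ e : SignedIndex n, e.1 = 1 :=
    ⟨.mk' 1 (by omega) (by omega) (by omega), rfl⟩
  obtain ⟨e2, he2⟩ : ∃ e : SignedIndex n, e.1 = 2 :=
    ⟨.mk' 2 (by omega) (by omega) (by omega), rfl⟩
  obtain ⟨e3, he3⟩ : ∃ e : SignedIndex n, e.1 = 3 :=
    ⟨.mk' 3 (by omega) (by omega) (by omega), rfl⟩
  have base : signedReflection e1 e2 (by omega) (by omega) ∈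
      reflections (evenHyperoctahedralGenerators n) :=
    ⟨1, _, mem_generators_iff.2 ⟨e1, e2, by omega, by omega,
      Or.inl ⟨by omega, by omega⟩, rfl⟩, by simp⟩
  have step1 : ∀ (j : SignedIndex n) (h : e1.1 ≠ j.1) (h' : e1.1 ≠ -j.1),
      signedReflection e1 j h h' ∈ reflections (evenHyperoctahedralGenerators n) := by
    intro j h h'
    have hj := j.ne_zero
    by_cases h2 : j.1 = 2
    · obtain rfl : e2 = j := Subtype.ext (he2.trans h2.symm)
      exact base
    by_cases h3 : j.1 = -2
    · have hc := SignedIndex.coe_neg e3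
      -- This product negates 2 and 3 and fixes 1.
      refine signedReflection_mem_reflections_of_conj
        (signedReflection e2 e3 (by omega) (by omega) *
          signedReflection e2 (-e3) (by omega) (by omega)) ?_ ?_ base
      · rw [mul_signedReflection_apply]
        simp [signedReflection, signedSwap_apply, he1, he2, he3]
      · rw [mul_signedReflection_apply]
        simp [signedReflection, signedSwap_apply, he2, he3, h3]
    · have h2' : e2.1 ≠ j.1 := by omega
      have h3' : e2.1 ≠ -j.1 := by omega
      refine signedReflection_mem_reflections_of_conj
        (signedReflection e2 j h2' h3') ?_ ?_ base
      · simp only [signedReflection, signedSwap_apply h2' h3']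
        split_ifs <;> omega
      · simp only [signedReflection, signedSwap_apply h2' h3', if_true]
  by_cases h1 : i.1 = 1
  · obtain rfl : e1 = i := Subtype.ext (he1.trans h1.symm)
    exact step1 j h h'
  by_cases h2 : i.1 = -1
  · have := step1 (-j) (by rw [SignedIndex.coe_neg]; omega) (by rw [SignedIndex.coe_neg]; omega)
    have e : signedReflection i j h h' =
        signedReflection e1 (-j) (by rw [SignedIndex.coe_neg]; omega) (by rw [SignedIndex.coe_neg]; omega) := by
      refine evenHyperoctahedral_ext fun k => ?_
      have hj := j.ne_zero
      simp only [signedReflection, signedSwap_apply h h']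
      rw [signedSwap_apply (by rw [SignedIndex.coe_neg]; omega) (by rw [SignedIndex.coe_neg]; omega)]
      simp only [SignedIndex.coe_neg]
      split_ifs <;> omega
    rw [e]
    exact this
  · have g : e1.1 ≠ i.1 := by omega
    have g' : e1.1 ≠ -i.1 := by omega
    -- `t` sends 1 to `i` and is an involution, so it carries the pair `1, t j` to `i, j`.
    let t := signedReflection e1 i g g'
    have hi := i.ne_zero
    have hj := j.ne_zero
    have hval : (t.1 j).1 ≠ 1 ∧ (t.1 j).1 ≠ -1 := by
      simp only [t, signedReflection, signedSwap_apply g g']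
      split_ifs <;> omega
    refine signedReflection_mem_reflections_of_conj t ?_ ?_
      (step1 (t.1 j) (by omega) (by omega))
    · simp only [t, signedReflection, signedSwap_apply g g', if_true]
    · have := congrArg (fun w => (w.1 j).1) (signedReflection_mul_self g g')
      exact this

theorem mem_reflections_iff (hn : 3 ≤ n) {t : evenHyperoctahedralGroup n} :
    t ∈ reflections (evenHyperoctahedralGenerators n) ↔
      ∃ (i j : SignedIndex n) (h : i.1 ≠ j.1) (h' : i.1 ≠ -j.1), t = signedReflection i j h h' := by
  constructor
  · rintro ⟨w, s, hs, rfl⟩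
    obtain ⟨i, j, h, h', _, rfl⟩ := mem_generators_iff.1 hs
    exact ⟨w.1 i, w.1 j, _, _, by rw [signedReflection_conj w h h', mul_inv_cancel_right]⟩
  · rintro ⟨i, j, h, h', rfl⟩
    exact signedReflection_mem_reflections hn h h'

end SignedSwap

/-! ### The length function of `D_n` -/

section Length

variable {n : ℕ}

/-- The indicator that the positions `a ≠ ± b` are inverted by `w`. -/
noncomputable def inverted (w : evenHyperoctahedralGroup n) (a b : SignedIndex n) : ℕ :=
  if b.1 ≠ -a.1 ∧ ((a.1 < b.1 ∧ (w.1 b).1 < (w.1 a).1) ∨ (b.1 < a.1 ∧ (w.1 a).1 < (w.1 b).1))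
  then 1 else 0

/-- The number of ordered pairs of inverted positions; four times the length. -/
noncomputable def inversionCount (w : evenHyperoctahedralGroup n) : ℕ :=
  ∑ a, ∑ b, inverted w a b

theorem inverted_comm (w : evenHyperoctahedralGroup n) (a b : SignedIndex n) :
    inverted w a b = inverted w b a := by
  unfold inverted
  exact if_congr (by omega) rfl rfl

theorem inverted_neg_neg (w : evenHyperoctahedralGroup n) (a b : SignedIndex n) :
    inverted w (-a) (-b) = inverted w a b := by
  unfold inverted
  refine if_congr ?_ rfl rfl
  simp only [SignedIndex.coe_neg, coe_apply_neg]
  omega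

theorem inverted_self (w : evenHyperoctahedralGroup n) (a : SignedIndex n) :
    inverted w a a = 0 := by
  unfold inverted
  exact if_neg (by omega)

theorem inverted_neg_self (w : evenHyperoctahedralGroup n) (a : SignedIndex n) :
    inverted w a (-a) = 0 := by
  unfold inverted
  exact if_neg (by simp)

theorem inversionCount_one : inversionCount (1 : evenHyperoctahedralGroup n) = 0 := by
  refine Finset.sum_eq_zero fun a _ => Finset.sum_eq_zero fun b _ => if_neg ?_
  simp only [OneMemClass.coe_one, Equiv.Perm.one_apply]
  omega

theorem card_signedOrbit_sum {i j : SignedIndex n} (h : i.1 ≠ j.1) (h' : i.1 ≠ -j.1)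
    (f : SignedIndex n → ℕ) :
    ∑ m ∈ ({i, j, -i, -j} : Finset (SignedIndex n)), f m = f i + (f j + (f (-i) + f (-j))) := by
  have hi := i.ne_zero
  have hj := j.ne_zero
  rw [Finset.sum_insert, Finset.sum_insert, Finset.sum_pair]
  all_goals
    simp only [Finset.mem_insert, Finset.mem_singleton, SignedIndex.eq_iff, SignedIndex.coe_neg,
      ne_eq]
    omega

/-- Separates what multiplication by the reflection in `i, j` can change. The factors 4 come from
the order of a pair and from the antipodal map. -/
theorem inversionCount_eq (w : evenHyperoctahedralGroup n) {i j : SignedIndex n}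
    (h : i.1 ≠ j.1) (h' : i.1 ≠ -j.1) :
    inversionCount w = ∑ a ∈ ({i, j, -i, -j} : Finset (SignedIndex n))ᶜ,
        ∑ b ∈ ({i, j, -i, -j} : Finset (SignedIndex n))ᶜ, inverted w a b
      + 4 * ∑ k ∈ ({i, j, -i, -j} : Finset (SignedIndex n))ᶜ, (inverted w k i + inverted w k j)
      + (4 * inverted w i j + 4 * inverted w i (-j)) := by
  set s : Finset (SignedIndex n) := {i, j, -i, -j} with hs
  have hneg : ∀ k, k ∈ s ↔ -k ∈ s := by
    intro k
    simp only [hs, Finset.mem_insert, Finset.mem_singleton, SignedIndex.eq_iff,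
      SignedIndex.coe_neg]
    omega
  have hflip : ∀ m, ∑ k ∈ sᶜ, inverted w k (-m) = ∑ k ∈ sᶜ, inverted w k m := by
    intro m
    refine Finset.sum_nbij' (fun k => -k) (fun k => -k) ?_ ?_ ?_ ?_ ?_
    · intro k hk
      rw [Finset.mem_compl] at hk ⊢
      rwa [← hneg]
    · intro k hk
      rw [Finset.mem_compl] at hk ⊢
      rwa [← hneg]
    · intro k _
      exact SignedIndex.neg_neg k
    · intro k _
      exact SignedIndex.neg_neg k
    · intro k _
      rw [← inverted_neg_neg w k, SignedIndex.neg_neg]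
  have hcross : ∑ a ∈ sᶜ, ∑ b ∈ s, inverted w a b
      = 2 * ∑ k ∈ sᶜ, (inverted w k i + inverted w k j) := by
    simp only [hs, card_signedOrbit_sum h h']
    rw [← hs]
    simp only [Finset.sum_add_distrib, hflip]
    ring
  have hcross' : ∑ a ∈ s, ∑ b ∈ sᶜ, inverted w a b
      = 2 * ∑ k ∈ sᶜ, (inverted w k i + inverted w k j) := by
    rw [← hcross, Finset.sum_comm]
    exact Finset.sum_congr rfl fun a _ => Finset.sum_congr rfl fun b _ => inverted_comm w b a
  have hin : ∑ a ∈ s, ∑ b ∈ s, inverted w a b = 4 * inverted w i j + 4 * inverted w i (-j) := by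
    simp only [hs, card_signedOrbit_sum h h']
    have e1 := inverted_neg_neg w i j
    have e2 := inverted_neg_neg w i (-j)
    have e3 := inverted_neg_self w (-i)
    have e4 := inverted_neg_self w (-j)
    rw [SignedIndex.neg_neg] at e2 e3 e4
    rw [inverted_self, inverted_self, inverted_self, inverted_self, inverted_neg_self,
      inverted_neg_self, e3, e4, e1, e2, inverted_comm w j i, inverted_comm w j (-i), e2,
      inverted_comm w (-j) i, inverted_comm w (-j) (-i), e1]
    ring
  have hsplit : ∀ f : SignedIndex n → ℕ, ∑ a, f a = ∑ a ∈ s, f a + ∑ a ∈ sᶜ, f a :=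
    fun f => (Finset.sum_add_sum_compl s f).symm
  unfold inversionCount
  rw [hsplit]
  simp only [hsplit (inverted w _), Finset.sum_add_distrib, hin, hcross, hcross']
  ring

theorem inverted_mul_signedReflection_of_notMem (w : evenHyperoctahedralGroup n)
    {i j : SignedIndex n} (h : i.1 ≠ j.1) (h' : i.1 ≠ -j.1) {a b : SignedIndex n}
    (ha : a ∈ ({i, j, -i, -j} : Finset (SignedIndex n))ᶜ)
    (hb : b ∈ ({i, j, -i, -j} : Finset (SignedIndex n))ᶜ) :
    inverted (w * signedReflection i j h h') a b = inverted w a b := by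
  simp only [Finset.mem_compl, Finset.mem_insert, Finset.mem_singleton, SignedIndex.eq_iff,
    SignedIndex.coe_neg, not_or] at ha hb
  unfold inverted
  rw [mul_signedReflection_apply, mul_signedReflection_apply]
  simp only [ha.1, ha.2.1, ha.2.2.1, ha.2.2.2, hb.1, hb.2.1, hb.2.2.1, hb.2.2.2, if_false]

/-- Pairs away from the orbit are unchanged. A position `k` off the orbit never loses inversions
with `i` and `j` together, and gains some only from inside the rectangle. The pair `i, j` itself
contributes the 4. Since `-i` and `-j` belong to the orbit, they never occur as such a `k`. -/
theorem inversionCount_add_four_le (w : evenHyperoctahedralGroup n) {i j : SignedIndex n}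
    (h : i.1 ≠ j.1) (h' : i.1 ≠ -j.1) (hij : i.1 < j.1) (hw : (w.1 i).1 < (w.1 j).1) :
    inversionCount w + 4 ≤ inversionCount (w * signedReflection i j h h') ∧
      ((∀ k : SignedIndex n, k.1 ≠ -i.1 → k.1 ≠ -j.1 → i.1 < k.1 → k.1 < j.1 →
        (w.1 i).1 < (w.1 k).1 → (w.1 k).1 < (w.1 j).1 → False) →
      inversionCount (w * signedReflection i j h h') = inversionCount w + 4) := by
  have hi := i.ne_zero
  have hj := j.ne_zero
  have vi := mul_signedReflection_apply w h h' i
  rw [if_pos rfl] at vi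
  have vj := mul_signedReflection_apply w h h' j
  rw [if_neg (Ne.symm h), if_pos rfl] at vj
  have d0 : inverted w i j = 0 := if_neg (by omega)
  have d1 : inverted (w * signedReflection i j h h') i j = 1 := by
    unfold inverted
    rw [vi, vj]
    exact if_pos (by omega)
  -- Whether the values at `i` and `-j` are in order depends only on the sign of `w i + w j`, which
  -- the exchange preserves.
  have d2 : inverted (w * signedReflection i j h h') i (-j) = inverted w i (-j) := by
    unfold inverted
    simp only [coe_apply_neg, SignedIndex.coe_neg]
    rw [vi, vj]
    exact if_congr (by omega) rfl rfl
  have hS : ∀ k ∈ ({i, j, -i, -j} : Finset (SignedIndex n))ᶜ,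
      (inverted w k i + inverted w k j ≤ inverted (w * signedReflection i j h h') k i +
        inverted (w * signedReflection i j h h') k j) ∧
      (((k.1 ≠ -i.1 → k.1 ≠ -j.1 → i.1 < k.1 → k.1 < j.1 →
        (w.1 i).1 < (w.1 k).1 → (w.1 k).1 < (w.1 j).1 → False)) →
      inverted (w * signedReflection i j h h') k i +
        inverted (w * signedReflection i j h h') k j = inverted w k i + inverted w k j) := by
    intro k hk
    simp only [Finset.mem_compl, Finset.mem_insert, Finset.mem_singleton, SignedIndex.eq_iff,
      SignedIndex.coe_neg, not_or] at hk
    have vk := mul_signedReflection_apply w h h' k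
    rw [if_neg hk.1, if_neg hk.2.1, if_neg hk.2.2.1, if_neg hk.2.2.2] at vk
    have n1 := (coe_apply_eq_iff w k i).not.2 hk.1
    have n2 := (coe_apply_eq_iff w k j).not.2 hk.2.1
    unfold inverted
    rw [vi, vj, vk]
    constructor
    · split_ifs <;> omega
    · intro hr
      have hr' : ¬(i.1 < k.1 ∧ k.1 < j.1 ∧ (w.1 i).1 < (w.1 k).1 ∧ (w.1 k).1 < (w.1 j).1) :=
        fun ⟨r1, r2, r3, r4⟩ => hr hk.2.2.1 hk.2.2.2 r1 r2 r3 r4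
      split_ifs <;> omega
  have hout : ∑ a ∈ ({i, j, -i, -j} : Finset (SignedIndex n))ᶜ,
        ∑ b ∈ ({i, j, -i, -j} : Finset (SignedIndex n))ᶜ,
          inverted (w * signedReflection i j h h') a b = 
      ∑ a ∈ ({i, j, -i, -j} : Finset (SignedIndex n))ᶜ,
        ∑ b ∈ ({i, j, -i, -j} : Finset (SignedIndex n))ᶜ, inverted w a b :=
    Finset.sum_congr rfl fun a ha => Finset.sum_congr rfl fun b hb =>
      inverted_mul_signedReflection_of_notMem w h h' ha hb
  rw [inversionCount_eq w h h', inversionCount_eq (w * signedReflection i j h h') h h', hout,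
    d0, d1, d2]
  constructor
  · have := Finset.sum_le_sum fun k hk => (hS k hk).1
    omega
  · intro hr
    have := Finset.sum_congr rfl fun k hk => (hS k hk).2 (hr k)
    omega

theorem inversionCount_lt_iff (w : evenHyperoctahedralGroup n) {i j : SignedIndex n}
    (h : i.1 ≠ j.1) (h' : i.1 ≠ -j.1) (hij : i.1 < j.1) :
    inversionCount (w * signedReflection i j h h') < inversionCount w ↔
      (w.1 j).1 < (w.1 i).1 := by
  constructor
  · intro hlt
    by_contra hw
    have hne := (coe_apply_eq_iff w i j).not.2 h
    have := (inversionCount_add_four_le w h h' hij (by omega)).1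
    omega
  · intro hw
    have vi := mul_signedReflection_apply w h h' i
    rw [if_pos rfl] at vi
    have vj := mul_signedReflection_apply w h h' j
    rw [if_neg (Ne.symm h), if_pos rfl] at vj
    have := (inversionCount_add_four_le (w * signedReflection i j h h') h h' hij
      (by rw [vi, vj]; exact hw)).1
    rw [mul_signedReflection_cancel] at this
    omega

theorem inversionCount_of_empty (w : evenHyperoctahedralGroup n) {i j : SignedIndex n}
    (h : i.1 ≠ j.1) (h' : i.1 ≠ -j.1) (hij : i.1 < j.1) (hw : (w.1 j).1 < (w.1 i).1)
    (he : ∀ k : SignedIndex n, k.1 ≠ -i.1 → k.1 ≠ -j.1 → i.1 < k.1 → k.1 < j.1 →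
        (w.1 j).1 < (w.1 k).1 → (w.1 k).1 < (w.1 i).1 → False) :
    inversionCount w = inversionCount (w * signedReflection i j h h') + 4 := by
  have vi := mul_signedReflection_apply w h h' i
  rw [if_pos rfl] at vi
  have vj := mul_signedReflection_apply w h h' j
  rw [if_neg (Ne.symm h), if_pos rfl] at vj
  have := (inversionCount_add_four_le (w * signedReflection i j h h') h h' hij
      (by rw [vi, vj]; exact hw)).2 (by
    intro k k1 k2 k3 k4
    rw [vi, vj, mul_signedReflection_apply, if_neg (by omega), if_neg (by omega), if_neg k1,
      if_neg k2]
    exact he k k1 k2 k3 k4)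
  rwa [mul_signedReflection_cancel] at this

/-- No position lies strictly between the two positions of a generator, except `-1` between `-2` and
`1`, which is ignored as an antipode. -/
theorem inversionCount_mul_generator (w : evenHyperoctahedralGroup n) {i j : SignedIndex n}
    (h : i.1 ≠ j.1) (h' : i.1 ≠ -j.1)
    (hg : (0 < i.1 ∧ j.1 = i.1 + 1) ∨ (i.1 = 1 ∧ j.1 = -2)) :
    inversionCount (w * signedReflection i j h h') ≤ inversionCount w + 4 := by
  rcases hg with hg | hg
  · rcases lt_or_ge (w.1 i).1 (w.1 j).1 with hw | hw
    · exact ((inversionCount_add_four_le w h h' (by omega) hw).2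
        (by intro k; omega)).le
    · have := (inversionCount_lt_iff w h h' (by omega)).2
        (lt_of_le_of_ne hw (Ne.symm ((coe_apply_eq_iff w i j).not.2 h)))
      omega
  · rw [signedReflection_comm]
    rcases lt_or_ge (w.1 j).1 (w.1 i).1 with hw | hw
    · refine ((inversionCount_add_four_le w _ _ (by omega) hw).2 ?_).le
      intro k
      have := k.ne_zero
      omega
    · have := (inversionCount_lt_iff w h.symm (by omega : j.1 ≠ -i.1) (by omega)).2
        (lt_of_le_of_ne hw ((coe_apply_eq_iff w i j).not.2 h))
      omega

/-- The hypothesis says `-w 2 < w 1 < w 2 < w 3 < ⋯`. So only `w 1` could be negative, and parity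
forbids a single sign change. An increasing positive window is the identity. -/
theorem eq_one_of_no_descent (hn : 3 ≤ n) (w : evenHyperoctahedralGroup n)
    (hw : ∀ i j : SignedIndex n, (0 < i.1 ∧ j.1 = i.1 + 1) ∨ (i.1 = -2 ∧ j.1 = 1) →
      (w.1 i).1 < (w.1 j).1) : w = 1 := by
  obtain ⟨e1, he1⟩ : ∃ e : SignedIndex n, e.1 = 1 :=
    ⟨.mk' 1 (by omega) (by omega) (by omega), rfl⟩
  obtain ⟨e2, he2⟩ : ∃ e : SignedIndex n, e.1 = 2 :=
    ⟨.mk' 2 (by omega) (by omega) (by omega), rfl⟩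
  have h12 := hw e1 e2 (by omega)
  have h21 := hw (-e2) e1 (by rw [SignedIndex.coe_neg]; omega)
  rw [coe_apply_neg] at h21
  have hpos : ∀ k : ℕ, ∀ a : SignedIndex n, a.1 = k + 2 → (w.1 e2).1 + k ≤ (w.1 a).1 := by
    intro k
    induction k with
    | zero =>
      intro a ha
      rw [coe_apply_congr w (show a.1 = e2.1 by omega)]
      simp
    | succ k ih =>
      intro a ha
      have hb := a.bounds
      let b : SignedIndex n := .mk' (k + 2) (by omega) (by omega) (by push_cast at ha; omega)
      have h1 := ih b rfl
      have h2 := hw b a (Or.inl ⟨by simp only [b, SignedIndex.coe_mk']; omega,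
        by simp only [b, SignedIndex.coe_mk']; push_cast at ha; omega⟩)
      push_cast
      omega
  have hpos1 : 0 < (w.1 e1).1 := by
    by_contra hneg
    have hs : negSet w.1 = {e1} := by
      ext a
      simp only [negSet, Finset.mem_filter, Finset.mem_univ, true_and, Finset.mem_singleton]
      constructor
      · rintro ⟨h0, h1⟩
        by_contra hne
        rw [SignedIndex.eq_iff] at hne
        have := hpos (a.1 - 2).toNat a (by omega)
        omega
      · rintro rfl
        have := (w.1 a).ne_zero
        omega
    have := w.2.2
    rw [hs] at this
    simp at this
  have hge : ∀ a : SignedIndex n, 0 < a.1 → a.1 ≤ (w.1 a).1 := by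
    intro a ha
    by_cases h1 : a.1 = 1
    · rw [coe_apply_congr w (show a.1 = e1.1 by omega)]
      omega
    · have := hpos (a.1 - 2).toNat a (by omega)
      omega
  have hle : ∀ k : ℕ, ∀ a : SignedIndex n, 0 < a.1 → a.1 + k = n → (w.1 a).1 ≤ a.1 := by
    intro k
    induction k with
    | zero =>
      intro a _ ha
      have := (w.1 a).bounds
      push_cast at ha
      omega
    | succ k ih =>
      intro a h0 ha
      push_cast at ha
      let b : SignedIndex n := .mk' (a.1 + 1) (by omega) (by omega) (by omega)
      have h1 := ih b (by simp only [b, SignedIndex.coe_mk']; omega)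
        (by simp only [b, SignedIndex.coe_mk']; omega)
      have h2 := hw a b (Or.inl ⟨h0, rfl⟩)
      simp only [b, SignedIndex.coe_mk'] at h1 h2
      omega
  have hfix : ∀ a : SignedIndex n, 0 < a.1 → (w.1 a).1 = a.1 := by
    intro a ha
    have hb := a.bounds
    have h1 := hge a ha
    have h2 := hle (n - a.1).toNat a ha (by omega)
    omega
  refine evenHyperoctahedral_ext fun a => ?_
  have h0 := a.ne_zero
  change (w.1 a).1 = a.1
  rcases lt_or_gt_of_ne h0 with h | h
  · have h1 := hfix (-a) (by rw [SignedIndex.coe_neg]; omega)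
    rw [coe_apply_neg, SignedIndex.coe_neg] at h1
    omega
  · exact hfix a h

theorem exists_word (hn : 3 ≤ n) (w : evenHyperoctahedralGroup n) :
    ∃ l : List (evenHyperoctahedralGroup n), (∀ s ∈ l, s ∈ evenHyperoctahedralGenerators n) ∧
      l.prod = w ∧ 4 * l.length ≤ inversionCount w := by
  induction hk : inversionCount w using Nat.strong_induction_on generalizing w with
  | _ k ih =>
    by_cases hw : w = 1
    · exact ⟨[], by simp, by simp [hw], by simp⟩
    · have : ∃ (i j : SignedIndex n) (h : i.1 ≠ j.1) (h' : i.1 ≠ -j.1),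
          signedReflection i j h h' ∈ evenHyperoctahedralGenerators n ∧
            inversionCount (w * signedReflection i j h h') + 4 ≤ inversionCount w := by
        by_contra hcon
        push Not at hcon
        refine hw (eq_one_of_no_descent hn w fun i j hij => ?_)
        by_contra hlt
        have h : i.1 ≠ j.1 := by omega
        have h' : i.1 ≠ -j.1 := by omega
        have hmem : signedReflection i j h h' ∈ evenHyperoctahedralGenerators n := by
          rcases hij with hij | hij
          · exact mem_generators_iff.2 ⟨i, j, h, h', Or.inl hij, rfl⟩
          · exact mem_generators_iff.2 ⟨j, i, h.symm, by omega, Or.inr ⟨hij.2, hij.1⟩,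
              signedReflection_comm h h'⟩
        have h1 := hcon i j h h' hmem
        have hne := (coe_apply_eq_iff w i j).not.2 h
        have h2 := inversionCount_of_empty w h h' (by omega) (by omega) (by
          intro k
          have := k.ne_zero
          omega)
        omega
      obtain ⟨i, j, h, h', hmem, hlt⟩ := this
      obtain ⟨l, hl, hp, hlen⟩ := ih _ (by omega) (w * signedReflection i j h h') rfl
      refine ⟨l ++ [signedReflection i j h h'], ?_, ?_, ?_⟩
      · intro s hs
        rcases List.mem_append.1 hs with hs | hs
        · exact hl s hs
        · rw [List.mem_singleton.1 hs]
          exact hmem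
      · rw [List.prod_append, hp, List.prod_singleton, mul_signedReflection_cancel]
      · rw [List.length_append, List.length_singleton]
        omega

theorem inversionCount_prod_le (l : List (evenHyperoctahedralGroup n))
    (hl : ∀ s ∈ l, s ∈ evenHyperoctahedralGenerators n) :
    inversionCount l.prod ≤ 4 * l.length := by
  induction l using List.reverseRecOn with
  | nil => simp [inversionCount_one]
  | append_singleton l s ih =>
    obtain ⟨i, j, h, h', hg, rfl⟩ := mem_generators_iff.1 (hl s (by simp))
    have h1 := ih fun s hs => hl s (by simp [hs])
    have h2 := inversionCount_mul_generator l.prod h h' hg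
    rw [List.prod_append, List.prod_singleton, List.length_append, List.length_singleton]
    omega

/-- A generator adds at most 4 to the count, and every element other than 1 has a descent at a
generator, which lowers it by exactly 4. -/
theorem four_mul_wordLength (hn : 3 ≤ n) (w : evenHyperoctahedralGroup n) :
    4 * wordLength (evenHyperoctahedralGenerators n) w = inversionCount w := by
  obtain ⟨l, hl, hp, hlen⟩ := exists_word hn w
  have hmem : l.length ∈ {k : ℕ | ∃ l : List (evenHyperoctahedralGroup n),
      (∀ s ∈ l, s ∈ evenHyperoctahedralGenerators n) ∧ l.prod = w ∧ l.length = k} :=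
    ⟨l, hl, hp, rfl⟩
  obtain ⟨l', hl', hp', hlen'⟩ := Nat.sInf_mem ⟨_, hmem⟩
  have h1 := Nat.sInf_le hmem
  have h2 := inversionCount_prod_le l' hl'
  rw [hp', hlen'] at h2
  unfold wordLength
  omega

end Length

/-! ### Covers of the Bruhat order and degrees in its Hasse diagram -/

/-- `b` lies strictly between `a` and `c`. -/
def StrictlyBetween (a b c : ℤ) : Prop := (a < b ∧ b < c) ∨ (c < b ∧ b < a)

/-- The positions `p ≠ ± q` in the symmetric set `X` see each other with respect to `w`: the
rectangle spanned by the points `(p, w p)` and `(q, w q)` has no point `(k, w k)` with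
`k ∈ X \ {±p, ±q}` in its interior. -/
def Sees (X : Finset ℤ) (w : ℤ → ℤ) (p q : ℤ) : Prop :=
  p ≠ q ∧ p ≠ -q ∧ ∀ k ∈ X, k ≠ p → k ≠ -p → k ≠ q → k ≠ -q →
    ¬(StrictlyBetween p k q ∧ StrictlyBetween (w p) (w k) (w q))

theorem Sees.symm {X : Finset ℤ} {w : ℤ → ℤ} {p q : ℤ} (h : Sees X w p q) : Sees X w q p := by
  refine ⟨h.1.symm, by have := h.2.1; omega, fun k hk h1 h2 h3 h4 hb => h.2.2 k hk h3 h4 h1 h2 ?_⟩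
  unfold StrictlyBetween at *
  omega

section Covers

variable {n : ℕ}

/-- A permutation of `{±1, …, ±n}` as a function on the integers. -/
noncomputable def toIntFun (w : evenHyperoctahedralGroup n) (x : ℤ) : ℤ :=
  if h : x ∈ (Finset.Icc (-(n : ℤ)) (n : ℤ)).erase 0 then (w.1 ⟨x, h⟩).1 else 0

theorem toIntFun_coe (w : evenHyperoctahedralGroup n) (i : SignedIndex n) :
    toIntFun w i.1 = (w.1 i).1 := dif_pos i.2

theorem sees_iff (w : evenHyperoctahedralGroup n) (i j : SignedIndex n) :
    Sees ((Finset.Icc (-(n : ℤ)) (n : ℤ)).erase 0) (toIntFun w) i.1 j.1 ↔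
      i.1 ≠ j.1 ∧ i.1 ≠ -j.1 ∧ ∀ k : SignedIndex n, k.1 ≠ i.1 → k.1 ≠ -i.1 → k.1 ≠ j.1 →
        k.1 ≠ -j.1 → ¬(StrictlyBetween i.1 k.1 j.1 ∧
          StrictlyBetween (w.1 i).1 (w.1 k).1 (w.1 j).1) := by
  unfold Sees
  simp only [toIntFun_coe]
  refine and_congr_right fun _ => and_congr_right fun _ => ⟨fun h k => ?_, fun h k hk => ?_⟩
  · have := h k.1 k.2
    rwa [toIntFun_coe] at this
  · rw [show toIntFun w k = (w.1 ⟨k, hk⟩).1 from dif_pos hk]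
    exact h ⟨k, hk⟩

theorem bruhatStep_iff (hn : 3 ≤ n) {u v : evenHyperoctahedralGroup n} :
    BruhatStep (evenHyperoctahedralGenerators n) u v ↔
      ∃ (i j : SignedIndex n) (h : i.1 ≠ j.1) (h' : i.1 ≠ -j.1),
        i.1 < j.1 ∧ (v.1 j).1 < (v.1 i).1 ∧ u = v * signedReflection i j h h' := by
  have hl := four_mul_wordLength hn u
  have hl' := four_mul_wordLength hn v
  constructor
  · rintro ⟨⟨t, ht, rfl⟩, hlt⟩
    obtain ⟨i, j, h, h', rfl⟩ := (mem_reflections_iff hn).1 ht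
    have key : signedReflection i j h h' * v =
        v * signedReflection (v⁻¹.1 i) (v⁻¹.1 j) (by rwa [Ne, coe_apply_eq_iff])
          (by rwa [Ne, coe_apply_eq_neg_iff]) := by
      have := signedReflection_conj v⁻¹ h h'
      rw [← mul_left_inj v, mul_assoc, mul_assoc, inv_mul_cancel, mul_one, inv_mul_eq_iff_eq_mul]
        at this
      exact this
    have hlt' : inversionCount (signedReflection i j h h' * v) < inversionCount v := by omega
    rw [key] at hlt' ⊢
    have hne : (v⁻¹.1 i).1 ≠ (v⁻¹.1 j).1 := by rwa [Ne, coe_apply_eq_iff]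
    have hne' : (v⁻¹.1 i).1 ≠ -(v⁻¹.1 j).1 := by rwa [Ne, coe_apply_eq_neg_iff]
    rcases lt_or_gt_of_ne hne with hij | hij
    · exact ⟨_, _, hne, hne', hij, (inversionCount_lt_iff v hne hne' hij).1 hlt', rfl⟩
    · have hc := signedReflection_comm hne hne'
      rw [hc] at hlt' ⊢
      exact ⟨_, _, hne.symm, _, hij, (inversionCount_lt_iff v hne.symm _ hij).1 hlt', rfl⟩
  · rintro ⟨i, j, h, h', hij, hv, rfl⟩
    refine ⟨⟨_, (mem_reflections_iff hn).2 ⟨v.1 i, v.1 j, _, _, rfl⟩,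
      signedReflection_conj v h h'⟩, ?_⟩
    have := (inversionCount_lt_iff v h h' hij).2 hv
    omega

theorem bruhat_lt_of_step {S : Set (evenHyperoctahedralGroup n)}
    {u v : evenHyperoctahedralGroup n} (h : BruhatStep S u v) :
    (bruhatOrder S).lt u v := by
  let := bruhatOrder S
  refine lt_of_le_of_ne (Relation.ReflTransGen.single h) ?_
  rintro rfl
  exact lt_irrefl _ h.2

theorem wordLength_lt_of_bruhat_lt {S : Set (evenHyperoctahedralGroup n)}
    {u v : evenHyperoctahedralGroup n} (h : (bruhatOrder S).lt u v) :
    wordLength S u < wordLength S v := by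
  let := bruhatOrder S
  have h' : u < v := h
  rcases wordLength_le_of_chain (show Relation.ReflTransGen (BruhatStep S) u v from h'.le)
    with h1 | h1
  · exact absurd h1 h'.ne
  · exact h1

/-- Used to factor a non-covering step through a point `k` inside the rectangle. -/
theorem signedReflection_eq_mul {i k j : SignedIndex n} (hik : i.1 ≠ k.1) (hik' : i.1 ≠ -k.1)
    (hkj : k.1 ≠ j.1) (hkj' : k.1 ≠ -j.1) (hij : i.1 ≠ j.1) (hij' : i.1 ≠ -j.1) :
    signedReflection i j hij hij' =
      signedReflection i k hik hik' * signedReflection k j hkj hkj' *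
        signedReflection i k hik hik' := by
  rw [signedReflection_conj _ hkj hkj', mul_signedReflection_cancel]
  have e1 := signedSwap_apply hik hik' k
  have e2 := signedSwap_apply hik hik' j
  rw [if_neg hik.symm, if_pos rfl] at e1
  rw [if_neg hij.symm, if_neg hkj.symm, if_neg (by omega), if_neg (by omega)] at e2
  have g1 : (signedReflection i k hik hik').1 k = i := Subtype.ext e1
  have g2 : (signedReflection i k hik hik').1 j = j := Subtype.ext e2
  simp only [g1, g2]

/-- If a point `k` lies in the rectangle, exchanging `i, k`, then `k, j`, then `i, k` descends three
times from `v` to `u`. If the rectangle is empty, the length drops by exactly one and nothing fits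
between. -/
theorem bruhat_covBy_iff (hn : 3 ≤ n) {u v : evenHyperoctahedralGroup n} :
    @CovBy _ (bruhatOrder (evenHyperoctahedralGenerators n)).toLT u v ↔
      ∃ (i j : SignedIndex n) (h : i.1 ≠ j.1) (h' : i.1 ≠ -j.1),
        i.1 < j.1 ∧ (v.1 j).1 < (v.1 i).1 ∧
        Sees ((Finset.Icc (-(n : ℤ)) (n : ℤ)).erase 0) (toIntFun v) i.1 j.1 ∧
        u = v * signedReflection i j h h' := by
  let := bruhatOrder (evenHyperoctahedralGenerators n)
  constructor
  · intro hc
    have hstep : BruhatStep (evenHyperoctahedralGenerators n) u v := by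
      have hle : Relation.ReflTransGen (BruhatStep (evenHyperoctahedralGenerators n)) u v :=
        hc.lt.le
      rcases Relation.ReflTransGen.cases_tail hle with h | ⟨x, hux, hxv⟩
      · exact absurd h.symm hc.lt.ne
      · have hux' : u ≤ x := hux
        rcases eq_or_lt_of_le hux' with h | h
        · rwa [h]
        · exact absurd (bruhat_lt_of_step hxv) (hc.2 h)
    obtain ⟨i, j, h, h', hij, hv, rfl⟩ := (bruhatStep_iff hn).1 hstep
    refine ⟨i, j, h, h', hij, hv, (sees_iff v i j).2 ⟨h, h', ?_⟩, rfl⟩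
    intro k k1 k2 k3 k4 hb
    unfold StrictlyBetween at hb
    have hik : i.1 ≠ k.1 := Ne.symm k1
    have hik' : i.1 ≠ -k.1 := by omega
    have vi := mul_signedReflection_apply v hik hik' i
    have vk := mul_signedReflection_apply v hik hik' k
    have vj := mul_signedReflection_apply v hik hik' j
    have hi := i.ne_zero
    have hk := k.ne_zero
    rw [if_pos rfl] at vi
    rw [if_neg k1, if_pos rfl] at vk
    rw [if_neg (Ne.symm h), if_neg (Ne.symm k3), if_neg (by omega), if_neg (by omega)] at vj
    have s1 : BruhatStep (evenHyperoctahedralGenerators n) (v * signedReflection i k hik hik') v :=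
      (bruhatStep_iff hn).2 ⟨i, k, hik, hik', by omega, by omega, rfl⟩
    have s2 : BruhatStep (evenHyperoctahedralGenerators n)
        (v * signedReflection i k hik hik' * signedReflection k j k3 k4)
        (v * signedReflection i k hik hik') :=
      (bruhatStep_iff hn).2 ⟨k, j, k3, k4, by omega, by omega, rfl⟩
    have wi := mul_signedReflection_apply (v * signedReflection i k hik hik') k3 k4 i
    have wk := mul_signedReflection_apply (v * signedReflection i k hik hik') k3 k4 k
    rw [if_neg hik, if_neg h, if_neg hik', if_neg h'] at wi
    rw [if_pos rfl] at wk
    have s3 : BruhatStep (evenHyperoctahedralGenerators n)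
        (v * signedReflection i k hik hik' * signedReflection k j k3 k4 *
          signedReflection i k hik hik')
        (v * signedReflection i k hik hik' * signedReflection k j k3 k4) :=
      (bruhatStep_iff hn).2 ⟨i, k, hik, hik', by omega, by omega, rfl⟩
    have e : v * signedReflection i j h h' = v * signedReflection i k hik hik' *
        signedReflection k j k3 k4 * signedReflection i k hik hik' := by
      rw [signedReflection_eq_mul hik hik' k3 k4 h h']
      simp only [mul_assoc]
    rw [← e] at s3
    have l1 : v * signedReflection i k hik hik' < v := bruhat_lt_of_step s1
    have l2 := bruhat_lt_of_step s2
    have l3 := bruhat_lt_of_step s3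
    exact hc.2 (lt_trans l3 l2) l1
  · rintro ⟨i, j, h, h', hij, hv, hs, rfl⟩
    have hstep := (bruhatStep_iff hn).2 ⟨i, j, h, h', hij, hv, rfl⟩
    refine ⟨bruhat_lt_of_step hstep, fun x hx hx' => ?_⟩
    have h1 := wordLength_lt_of_bruhat_lt hx
    have h2 := wordLength_lt_of_bruhat_lt hx'
    have h3 := four_mul_wordLength hn v
    have h4 := four_mul_wordLength hn (v * signedReflection i j h h')
    have h5 := inversionCount_of_empty v h h' hij hv (by
      intro k k1 k2 k3 k4 k5 k6
      exact ((sees_iff v i j).1 hs).2.2 k (by omega) k1 (by omega) k2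
        ⟨Or.inl ⟨k3, k4⟩, Or.inr ⟨k5, k6⟩⟩)
    omega

/-- Exchanging the two values gives the same rectangle, so upward and downward covers obey one
criterion. -/
theorem sees_mul_signedReflection (w : evenHyperoctahedralGroup n) {i j : SignedIndex n}
    (h : i.1 ≠ j.1) (h' : i.1 ≠ -j.1)
    (hs : Sees ((Finset.Icc (-(n : ℤ)) (n : ℤ)).erase 0) (toIntFun w) i.1 j.1) :
    Sees ((Finset.Icc (-(n : ℤ)) (n : ℤ)).erase 0)
      (toIntFun (w * signedReflection i j h h')) i.1 j.1 := by
  rw [sees_iff] at hs ⊢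
  refine ⟨h, h', fun k k1 k2 k3 k4 hb => hs.2.2 k k1 k2 k3 k4 ?_⟩
  rw [mul_signedReflection_apply, mul_signedReflection_apply, mul_signedReflection_apply,
    if_pos rfl, if_neg (Ne.symm h), if_pos rfl, if_neg k1, if_neg k3, if_neg k2, if_neg k4] at hb
  unfold StrictlyBetween at *
  omega

/-- The condition `-j < i < j` selects one representative of the four ordered pairs giving the same
reflection. -/
theorem hasseD_adj_iff (hn : 3 ≤ n) {u w : evenHyperoctahedralGroup n} :
    (hasseD n).Adj w u ↔ ∃ (i j : SignedIndex n) (h : i.1 ≠ j.1) (h' : i.1 ≠ -j.1),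
      -j.1 < i.1 ∧ i.1 < j.1 ∧
      Sees ((Finset.Icc (-(n : ℤ)) (n : ℤ)).erase 0) (toIntFun w) i.1 j.1 ∧
        u = w * signedReflection i j h h' := by
  have hcan : (hasseD n).Adj w u ↔ ∃ (i j : SignedIndex n) (h : i.1 ≠ j.1) (h' : i.1 ≠ -j.1),
      i.1 < j.1 ∧ Sees ((Finset.Icc (-(n : ℤ)) (n : ℤ)).erase 0) (toIntFun w) i.1 j.1 ∧
        u = w * signedReflection i j h h' := by
    change @CovBy _ (bruhatOrder (evenHyperoctahedralGenerators n)).toLT w u ∨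
      @CovBy _ (bruhatOrder (evenHyperoctahedralGenerators n)).toLT u w ↔ _
    rw [bruhat_covBy_iff hn, bruhat_covBy_iff hn]
    constructor
    · rintro (⟨i, j, h, h', hij, hv, hs, rfl⟩ | ⟨i, j, h, h', hij, hv, hs, rfl⟩)
      · exact ⟨i, j, h, h', hij, sees_mul_signedReflection u h h' hs,
          (mul_signedReflection_cancel u h h').symm⟩
      · exact ⟨i, j, h, h', hij, hs, rfl⟩
    · rintro ⟨i, j, h, h', hij, hs, rfl⟩
      have hne := (coe_apply_eq_iff w i j).not.2 h
      rcases lt_or_gt_of_ne hne with hv | hv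
      · refine Or.inl ⟨i, j, h, h', hij, ?_, sees_mul_signedReflection w h h' hs,
          (mul_signedReflection_cancel w h h').symm⟩
        rw [mul_signedReflection_apply, mul_signedReflection_apply, if_pos rfl,
          if_neg (Ne.symm h), if_pos rfl]
        exact hv
      · exact Or.inr ⟨i, j, h, h', hij, hv, hs, rfl⟩
  rw [hcan]
  constructor
  · rintro ⟨i, j, h, h', hij, hs, rfl⟩
    by_cases hlt : -j.1 < i.1
    · exact ⟨i, j, h, h', hlt, hij, hs, rfl⟩
    -- The pair `-j, -i` defines the same reflection and spans the antipodal rectangle.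
    · refine ⟨-j, -i, ?_, ?_, ?_, ?_, ?_, ?_⟩
      · simp only [SignedIndex.coe_neg]
        omega
      · simp only [SignedIndex.coe_neg]
        omega
      · simp only [SignedIndex.coe_neg]
        omega
      · simp only [SignedIndex.coe_neg]
        omega
      · rw [sees_iff] at hs ⊢
        simp only [coe_apply_neg, SignedIndex.coe_neg]
        refine ⟨by omega, by omega, fun k k1 k2 k3 k4 hb =>
          hs.2.2 (-k) ?_ ?_ ?_ ?_ ?_⟩
        on_goal 5 =>
          simp only [coe_apply_neg, SignedIndex.coe_neg]
          unfold StrictlyBetween at *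
          omega
        all_goals
          rw [SignedIndex.coe_neg]
          omega
      · congr 1
        have hi := i.ne_zero
        have hj := j.ne_zero
        refine evenHyperoctahedral_ext fun k => ?_
        simp only [signedReflection]
        rw [signedSwap_apply h h', signedSwap_apply (by simp only [SignedIndex.coe_neg]; omega)
          (by simp only [SignedIndex.coe_neg]; omega)]
        simp only [SignedIndex.coe_neg]
        split_ifs <;> omega
  · rintro ⟨i, j, h, h', _, hij, hs, hu⟩
    exact ⟨i, j, h, h', hij, hs, hu⟩

/-- Under the normalization, `j` is the largest position that the transposition moves. -/
theorem le_of_signedSwap_eq {i j i' j' : SignedIndex n} (h1 : -j.1 < i.1) (h2 : i.1 < j.1)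
    (h1' : -j'.1 < i'.1) (h2' : i'.1 < j'.1) (e : signedSwap i j = signedSwap i' j') :
    j.1 ≤ j'.1 := by
  by_contra hlt
  have e2 := congrArg (fun t => (t j).1) e
  have hj := signedSwap_apply (show i.1 ≠ j.1 by omega) (by omega) j
  have hj' := signedSwap_apply (show i'.1 ≠ j'.1 by omega) (by omega) j
  rw [if_neg (by omega), if_pos rfl] at hj
  rw [if_neg (by omega), if_neg (by omega), if_neg (by omega), if_neg (by omega)] at hj'
  simp only [hj, hj'] at e2
  omega

theorem signedSwap_inj {i j i' j' : SignedIndex n} (h1 : -j.1 < i.1) (h2 : i.1 < j.1)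
    (h1' : -j'.1 < i'.1) (h2' : i'.1 < j'.1) (e : signedSwap i j = signedSwap i' j') :
    i.1 = i'.1 ∧ j.1 = j'.1 := by
  have hj := le_antisymm (le_of_signedSwap_eq h1 h2 h1' h2' e)
    (le_of_signedSwap_eq h1' h2' h1 h2 e.symm)
  obtain rfl : j = j' := Subtype.ext hj
  have e2 := congrArg (fun t => (t j).1) e
  have hj := signedSwap_apply (show i.1 ≠ j.1 by omega) (by omega) j
  have hj' := signedSwap_apply (show i'.1 ≠ j.1 by omega) (by omega) j
  rw [if_neg (by omega), if_pos rfl] at hj hj'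
  simp only [hj, hj'] at e2
  exact ⟨e2, rfl⟩

open Classical in
theorem hasseD_degree (hn : 3 ≤ n) (w : evenHyperoctahedralGroup n) :
    (hasseD n).degree w =
      ((((Finset.Icc (-(n : ℤ)) (n : ℤ)).erase 0) ×ˢ
        ((Finset.Icc (-(n : ℤ)) (n : ℤ)).erase 0)).filter fun p : ℤ × ℤ =>
          -p.2 < p.1 ∧ p.1 < p.2 ∧
          Sees ((Finset.Icc (-(n : ℤ)) (n : ℤ)).erase 0) (toIntFun w) p.1 p.2).card := by
  rw [← SimpleGraph.card_neighborFinset_eq_degree]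
  symm
  have hmem : ∀ p ∈ ((((Finset.Icc (-(n : ℤ)) (n : ℤ)).erase 0) ×ˢ
        ((Finset.Icc (-(n : ℤ)) (n : ℤ)).erase 0)).filter fun p : ℤ × ℤ =>
          -p.2 < p.1 ∧ p.1 < p.2 ∧
          Sees ((Finset.Icc (-(n : ℤ)) (n : ℤ)).erase 0) (toIntFun w) p.1 p.2),
      ∃ (i j : SignedIndex n), i.1 = p.1 ∧ j.1 = p.2 ∧ i.1 ≠ j.1 ∧ i.1 ≠ -j.1 ∧
        -j.1 < i.1 ∧ i.1 < j.1 ∧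
        Sees ((Finset.Icc (-(n : ℤ)) (n : ℤ)).erase 0) (toIntFun w) i.1 j.1 := by
    intro p hp
    rw [Finset.mem_filter, Finset.mem_product] at hp
    exact ⟨⟨p.1, hp.1.1⟩, ⟨p.2, hp.1.2⟩, rfl, rfl, hp.2.2.2.1, hp.2.2.2.2.1, hp.2.1, hp.2.2.1,
      hp.2.2.2⟩
  choose I J hI hJ hne hne' hlt hlt' hsees using hmem
  refine Finset.card_bij (fun p hp => w * signedReflection (I p hp) (J p hp) (hne p hp) (hne' p hp))
    ?_ ?_ ?_
  · intro p hp
    rw [SimpleGraph.mem_neighborFinset, hasseD_adj_iff hn]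
    exact ⟨I p hp, J p hp, hne p hp, hne' p hp, hlt p hp, hlt' p hp, hsees p hp, rfl⟩
  · intro p hp q hq he
    have e := mul_left_cancel he
    obtain ⟨e1, e2⟩ := signedSwap_inj (hlt p hp) (hlt' p hp) (hlt q hq) (hlt' q hq)
      (congrArg Subtype.val e)
    exact Prod.ext (by rw [← hI p hp, ← hI q hq, e1]) (by rw [← hJ p hp, ← hJ q hq, e2])
  · intro u hu
    rw [SimpleGraph.mem_neighborFinset, hasseD_adj_iff hn] at hu
    obtain ⟨i, j, h, h', h1, h2, hs, rfl⟩ := hu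
    have hp : (i.1, j.1) ∈ ((((Finset.Icc (-(n : ℤ)) (n : ℤ)).erase 0) ×ˢ
        ((Finset.Icc (-(n : ℤ)) (n : ℤ)).erase 0)).filter fun p : ℤ × ℤ =>
          -p.2 < p.1 ∧ p.1 < p.2 ∧
          Sees ((Finset.Icc (-(n : ℤ)) (n : ℤ)).erase 0) (toIntFun w) p.1 p.2) := by
      rw [Finset.mem_filter, Finset.mem_product]
      exact ⟨⟨i.2, j.2⟩, h1, h2, hs⟩
    refine ⟨_, hp, ?_⟩
    congr 1
    have g1 : I (i.1, j.1) hp = i := Subtype.ext (hI _ hp)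
    have g2 : J (i.1, j.1) hp = j := Subtype.ext (hJ _ hp)
    simp only [g1, g2]

end Covers

/-! ### Counting mutually visible points in centrally symmetric configurations -/

/-- `X` is a symmetric set of nonzero integers, and `w` is odd and injective on it. -/
structure SignedConfig (X : Finset ℤ) (w : ℤ → ℤ) : Prop where
  neg_mem : ∀ x ∈ X, -x ∈ X
  ne_zero : ∀ x ∈ X, x ≠ 0
  odd : ∀ x ∈ X, w (-x) = -w x
  inj : ∀ x ∈ X, ∀ y ∈ X, w x = w y → x = y

namespace SignedConfig

variable {X : Finset ℤ} {w : ℤ → ℤ}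

theorem map_ne (h : SignedConfig X w) {p q : ℤ} (hp : p ∈ X) (hq : q ∈ X) (hpq : p ≠ q) :
    w p ≠ w q := fun e => hpq (h.inj p hp q hq e)

theorem map_ne_neg (h : SignedConfig X w) {p q : ℤ} (hp : p ∈ X) (hq : q ∈ X) (hpq : p ≠ -q) :
    w p ≠ -w q := by
  rw [← h.odd q hq]
  exact h.map_ne hp (h.neg_mem q hq) hpq

theorem map_ne_zero (h : SignedConfig X w) {p : ℤ} (hp : p ∈ X) : w p ≠ 0 := by
  have h0 := h.ne_zero p hp
  have := h.map_ne_neg hp hp (by omega)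
  omega

theorem subset (h : SignedConfig X w) {Y : Finset ℤ} (hY : Y ⊆ X) (hneg : ∀ x ∈ Y, -x ∈ Y) :
    SignedConfig Y w :=
  ⟨hneg, fun x hx => h.ne_zero x (hY hx), fun x hx => h.odd x (hY hx),
    fun x hx y hy => h.inj x (hY hx) y (hY hy)⟩

theorem flip (h : SignedConfig X w) : SignedConfig X (fun x => -w x) :=
  ⟨h.neg_mem, h.ne_zero, fun x hx => by simp only [h.odd x hx],
    fun x hx y hy e => h.inj x hx y hy (by simpa using e)⟩

theorem sdiff_pair (h : SignedConfig X w) (a : ℤ) : SignedConfig (X \ {a, -a}) w := by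
  refine h.subset Finset.sdiff_subset fun x hx => ?_
  simp only [Finset.mem_sdiff, Finset.mem_insert, Finset.mem_singleton] at hx ⊢
  exact ⟨h.neg_mem x hx.1, by omega⟩

theorem sdiff_pair_pair (h : SignedConfig X w) (a c : ℤ) :
    SignedConfig (X \ {a, -a, c, -c}) w := by
  refine h.subset Finset.sdiff_subset fun x hx => ?_
  simp only [Finset.mem_sdiff, Finset.mem_insert, Finset.mem_singleton] at hx ⊢
  exact ⟨h.neg_mem x hx.1, by omega⟩

theorem card_sdiff_pair (h : SignedConfig X w) {a : ℤ} (ha : a ∈ X) :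
    (X \ {a, -a}).card + 2 = X.card := by
  have h0 := h.ne_zero a ha
  have hs : ({a, -a} : Finset ℤ) ⊆ X := by
    intro x hx
    simp only [Finset.mem_insert, Finset.mem_singleton] at hx
    rcases hx with rfl | rfl
    · exact ha
    · exact h.neg_mem _ ha
  rw [← Finset.card_sdiff_add_card_eq_card hs, Finset.card_pair (by omega)]

theorem card_sdiff_pair_pair (h : SignedConfig X w) {a c : ℤ} (ha : a ∈ X) (hc : c ∈ X)
    (hca : c ≠ a) (hca' : c ≠ -a) : (X \ {a, -a, c, -c}).card + 4 = X.card := by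
  have e : X \ {a, -a, c, -c} = (X \ {a, -a}) \ {c, -c} := by
    ext x
    simp only [Finset.mem_sdiff, Finset.mem_insert, Finset.mem_singleton]
    tauto
  have h1 := h.card_sdiff_pair ha
  have h2 := (h.sdiff_pair a).card_sdiff_pair (a := c) (by simp [hc, hca, hca'])
  rw [e]
  omega

end SignedConfig

section Sees

variable {X : Finset ℤ} {w : ℤ → ℤ} {p q k : ℤ}

theorem Sees.mono {Y : Finset ℤ} (h : Sees X w p q) (hY : Y ⊆ X) : Sees Y w p q :=
  ⟨h.1, h.2.1, fun k hk => h.2.2 k (hY hk)⟩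

theorem Sees.false_of_lt (h : Sees X w p q) (hk : k ∈ X) (h1 : k ≠ -p) (h2 : k ≠ -q)
    (hp : p < k) (hq : k < q) (hwp : w p < w k) (hwq : w k < w q) : False :=
  h.2.2 k hk (ne_of_gt hp) h1 (ne_of_lt hq) h2 ⟨Or.inl ⟨hp, hq⟩, Or.inl ⟨hwp, hwq⟩⟩

theorem Sees.false_of_gt (h : Sees X w p q) (hk : k ∈ X) (h1 : k ≠ -p) (h2 : k ≠ -q)
    (hp : p < k) (hq : k < q) (hwp : w k < w p) (hwq : w q < w k) : False :=
  h.2.2 k hk (ne_of_gt hp) h1 (ne_of_lt hq) h2 ⟨Or.inl ⟨hp, hq⟩, Or.inr ⟨hwq, hwp⟩⟩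

theorem Sees.neg (h : Sees X w p q) (hX : SignedConfig X w) (hp : p ∈ X) (hq : q ∈ X) :
    Sees X w (-p) (-q) := by
  refine ⟨by have := h.1; omega, by have := h.2.1; omega, fun k hk h1 h2 h3 h4 hb => ?_⟩
  refine h.2.2 (-k) (hX.neg_mem k hk) (by omega) (by omega) (by omega) (by omega) ?_
  rw [hX.odd p hp, hX.odd q hq] at hb
  rw [hX.odd k hk]
  unfold StrictlyBetween at *
  omega

theorem sees_neg_iff (hX : SignedConfig X w) (hp : p ∈ X) (hq : q ∈ X) :
    Sees X w (-p) q ↔ Sees X w p (-q) := by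
  constructor <;> intro h
  · have := h.neg hX (hX.neg_mem p hp) hq
    rwa [neg_neg] at this
  · have := h.neg hX hp (hX.neg_mem q hq)
    rwa [neg_neg] at this

theorem sees_flip_iff : Sees X (fun x => -w x) p q ↔ Sees X w p q := by
  unfold Sees StrictlyBetween
  refine and_congr_right fun _ => and_congr_right fun _ => forall_congr' fun k => ?_
  simp only [neg_lt_neg_iff]
  tauto

end Sees

open Classical in
/-- The number of ordered pairs of positions in `X` which see each other. -/
noncomputable def visiblePairs (X : Finset ℤ) (w : ℤ → ℤ) : ℕ :=
  ∑ p ∈ X, (X.filter (Sees X w p)).card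

open Classical in
/-- The positions off `±a, ±c` seen by both `a` and `c`. -/
noncomputable def commonSeen (X : Finset ℤ) (w : ℤ → ℤ) (a c : ℤ) : Finset ℤ :=
  (X \ {a, -a, c, -c}).filter fun p => Sees X w a p ∧ Sees X w c p

open Classical in
/-- The positions off `±a, ±c` seen by neither `a` nor `c`. -/
noncomputable def commonUnseen (X : Finset ℤ) (w : ℤ → ℤ) (a c : ℤ) : Finset ℤ :=
  (X \ {a, -a, c, -c}).filter fun p => ¬Sees X w a p ∧ ¬Sees X w c p

open Classical in
/-- The number of elements of `{c, -c}` seen by `a`. -/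
noncomputable def linkCount (X : Finset ℤ) (w : ℤ → ℤ) (a c : ℤ) : ℕ :=
  (if Sees X w a c then 1 else 0) + (if Sees X w a (-c) then 1 else 0)

section Counting

variable {X : Finset ℤ} {w : ℤ → ℤ}

theorem linkCount_le (X : Finset ℤ) (w : ℤ → ℤ) (a c : ℤ) : linkCount X w a c ≤ 2 := by
  unfold linkCount
  split_ifs <;> omega

theorem sees_of_linkCount {a c : ℤ} (h : 2 ≤ linkCount X w a c) : Sees X w a (-c) := by
  unfold linkCount at h
  by_contra hn
  rw [if_neg hn] at h
  split_ifs at h <;> omega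

theorem visiblePairs_flip : visiblePairs X (fun x => -w x) = visiblePairs X w := by
  unfold visiblePairs
  refine Finset.sum_congr rfl fun p _ => ?_
  congr 1
  ext q
  simp only [Finset.mem_filter, sees_flip_iff]

open Classical in
-- Only an inequality, because deleting `S` also deletes possible obstructions and may create new
-- visible pairs.
theorem visiblePairs_le_sdiff (S : Finset ℤ) (hS : S ⊆ X) :
    visiblePairs X w ≤ visiblePairs (X \ S) w +
      2 * ∑ s ∈ S, ((X \ S).filter (Sees X w s)).card +
      ∑ s ∈ S, (S.filter (Sees X w s)).card := by
  have hsplit : ∀ p, (X.filter (Sees X w p)).card =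
      ((X \ S).filter (Sees X w p)).card + (S.filter (Sees X w p)).card := by
    intro p
    rw [← Finset.card_union_of_disjoint, ← Finset.filter_union, Finset.sdiff_union_of_subset hS]
    exact Finset.disjoint_filter_filter Finset.sdiff_disjoint
  have hcross : ∑ p ∈ X \ S, (S.filter (Sees X w p)).card =
      ∑ s ∈ S, ((X \ S).filter (Sees X w s)).card := by
    simp only [Finset.card_filter]
    rw [Finset.sum_comm]
    exact Finset.sum_congr rfl fun s _ => Finset.sum_congr rfl fun p _ =>
      if_congr ⟨Sees.symm, Sees.symm⟩ rfl rfl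
  have hin : ∑ p ∈ X \ S, ((X \ S).filter (Sees X w p)).card ≤ visiblePairs (X \ S) w := by
    refine Finset.sum_le_sum fun p _ => Finset.card_le_card fun q hq => ?_
    rw [Finset.mem_filter] at hq ⊢
    exact ⟨hq.1, hq.2.mono Finset.sdiff_subset⟩
  unfold visiblePairs at hin ⊢
  rw [← Finset.sum_sdiff hS]
  simp only [hsplit, Finset.sum_add_distrib]
  rw [hcross]
  omega

open Classical in
theorem card_filter_sees_neg (hX : SignedConfig X w) {Y : Finset ℤ} (hY : Y ⊆ X)
    (hneg : ∀ x ∈ Y, -x ∈ Y) {a : ℤ} (ha : a ∈ X) :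
    (Y.filter (Sees X w (-a))).card = (Y.filter (Sees X w a)).card := by
  refine Finset.card_nbij' (fun x => -x) (fun x => -x) ?_ ?_ ?_ ?_
  · intro x hx
    simp only [Finset.coe_filter, Set.mem_ofPred_eq] at hx ⊢
    exact ⟨hneg x hx.1, (sees_neg_iff hX ha (hY hx.1)).1 hx.2⟩
  · intro x hx
    simp only [Finset.coe_filter, Set.mem_ofPred_eq] at hx ⊢
    exact ⟨hneg x hx.1, hx.2.neg hX ha (hY hx.1)⟩
  · intro x _
    exact neg_neg x
  · intro x _
    exact neg_neg x

open Classical in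
theorem visiblePairs_le_sdiff_pair (hX : SignedConfig X w) {a : ℤ} (ha : a ∈ X) :
    visiblePairs X w ≤ visiblePairs (X \ {a, -a}) w +
      4 * ((X \ {a, -a}).filter (Sees X w a)).card := by
  have h0 := hX.ne_zero a ha
  have hsub : ({a, -a} : Finset ℤ) ⊆ X := by
    intro x hx
    simp only [Finset.mem_insert, Finset.mem_singleton] at hx
    rcases hx with rfl | rfl
    · exact ha
    · exact hX.neg_mem _ ha
  have h1 := visiblePairs_le_sdiff (w := w) _ hsub
  have h2 : ∑ s ∈ ({a, -a} : Finset ℤ), (({a, -a} : Finset ℤ).filter (Sees X w s)).card = 0 := by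
    refine Finset.sum_eq_zero fun s hs => ?_
    rw [Finset.card_eq_zero, Finset.filter_eq_empty_iff]
    intro q hq hsq
    have e1 := hsq.1
    have e2 := hsq.2.1
    simp only [Finset.mem_insert, Finset.mem_singleton] at hs hq
    omega
  rw [h2, Finset.sum_pair (by omega), card_filter_sees_neg hX Finset.sdiff_subset
    (hX.sdiff_pair a).neg_mem ha] at h1
  omega

open Classical in
-- The positions seen by `a` and those seen by `c` are counted together by inclusion–exclusion; the
-- factor 4 is the two directions of a pair times the antipodal map.
theorem visiblePairs_le_sdiff_pair_pair (hX : SignedConfig X w) {a c : ℤ} (ha : a ∈ X)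
    (hc : c ∈ X) (hca : c ≠ a) (hca' : c ≠ -a) :
    visiblePairs X w + 4 * (commonUnseen X w a c).card ≤
      visiblePairs (X \ {a, -a, c, -c}) w + 4 * (X \ {a, -a, c, -c}).card +
        4 * (commonSeen X w a c).card + 4 * linkCount X w a c := by
  have h0 := hX.ne_zero a ha
  have h0' := hX.ne_zero c hc
  have hsub : ({a, -a, c, -c} : Finset ℤ) ⊆ X := by
    intro x hx
    simp only [Finset.mem_insert, Finset.mem_singleton] at hx
    rcases hx with rfl | rfl | rfl | rfl
    · exact ha
    · exact hX.neg_mem _ ha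
    · exact hc
    · exact hX.neg_mem _ hc
  have hsum : ∀ f : ℤ → ℕ, ∑ s ∈ ({a, -a, c, -c} : Finset ℤ), f s =
      f a + (f (-a) + (f c + f (-c))) := by
    intro f
    rw [Finset.sum_insert, Finset.sum_insert, Finset.sum_pair]
    all_goals
      simp only [Finset.mem_insert, Finset.mem_singleton, ne_eq]
      omega
  have h1 := visiblePairs_le_sdiff (w := w) _ hsub
  have hneg := (hX.sdiff_pair_pair a c).neg_mem
  have hself : ∀ x, ¬Sees X w x x := fun x h => h.1 rfl
  have hself' : ∀ x, ¬Sees X w x (-x) := fun x h => h.2.1 (by omega)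
  have hself'' : ∀ x, ¬Sees X w (-x) x := fun x h => h.2.1 rfl
  have h2 : ∑ s ∈ ({a, -a, c, -c} : Finset ℤ),
      (({a, -a, c, -c} : Finset ℤ).filter (Sees X w s)).card = 4 * linkCount X w a c := by
    simp only [Finset.card_filter, hsum, hself, hself', hself'', if_false]
    have e1 : Sees X w (-a) c ↔ Sees X w a (-c) := sees_neg_iff hX ha hc
    have e2 : Sees X w (-a) (-c) ↔ Sees X w a c := by
      rw [sees_neg_iff hX ha (hX.neg_mem c hc), neg_neg]
    have e3 : Sees X w c a ↔ Sees X w a c := ⟨Sees.symm, Sees.symm⟩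
    have e4 : Sees X w c (-a) ↔ Sees X w a (-c) := ⟨fun h => e1.1 h.symm, fun h => (e1.2 h).symm⟩
    have e5 : Sees X w (-c) a ↔ Sees X w a (-c) := ⟨Sees.symm, Sees.symm⟩
    have e6 : Sees X w (-c) (-a) ↔ Sees X w a c := ⟨fun h => e2.1 h.symm, fun h => (e2.2 h).symm⟩
    simp only [e1, e2, e3, e4, e5, e6]
    unfold linkCount
    omega
  have h3 : ((X \ {a, -a, c, -c}).filter (Sees X w a)).card +
      ((X \ {a, -a, c, -c}).filter (Sees X w c)).card + (commonUnseen X w a c).card =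
      (X \ {a, -a, c, -c}).card + (commonSeen X w a c).card := by
    unfold commonUnseen commonSeen
    simp only [Finset.card_filter]
    rw [Finset.card_eq_sum_ones, ← Finset.sum_add_distrib, ← Finset.sum_add_distrib,
      ← Finset.sum_add_distrib]
    refine Finset.sum_congr rfl fun p _ => ?_
    by_cases g1 : Sees X w a p <;> by_cases g2 : Sees X w c p <;> simp [g1, g2]
  rw [h2, hsum, card_filter_sees_neg hX Finset.sdiff_subset hneg ha,
    card_filter_sees_neg hX Finset.sdiff_subset hneg hc] at h1
  omega

theorem visiblePairs_le (hX : SignedConfig X w) :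
    visiblePairs X w ≤ X.card * (X.card - 2) := by
  classical
  unfold visiblePairs
  rw [← smul_eq_mul]
  refine Finset.sum_le_card_nsmul _ _ _ fun p hp => ?_
  have h1 := hX.card_sdiff_pair hp
  have h2 : (X.filter (Sees X w p)).card ≤ (X \ {p, -p}).card := by
    refine Finset.card_le_card fun q hq => ?_
    rw [Finset.mem_filter] at hq
    have e1 := hq.2.1
    have e2 := hq.2.2.1
    simp only [Finset.mem_sdiff, Finset.mem_insert, Finset.mem_singleton]
    exact ⟨hq.1, by omega⟩
  omega

theorem card_le_two_of_antipodal {T : Finset ℤ} (h : ∀ p ∈ T, ∀ q ∈ T, q = p ∨ q = -p) :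
    T.card ≤ 2 := by
  rcases T.eq_empty_or_nonempty with rfl | ⟨p, hp⟩
  · simp
  · refine (Finset.card_le_card (t := {p, -p}) fun q hq => ?_).trans Finset.card_le_two
    simp only [Finset.mem_insert, Finset.mem_singleton]
    exact h p hp q hq

/-- A count by the antipodal map: if outside a set of at most five elements no two antipodal
elements of `Y` have the property `P`, and `P` fails on three elements not antipodal to any
such element, then at most `card Y / 2 + 1` elements have `P`. -/
theorem card_filter_le_of_antipodal {Y K U : Finset ℤ} {P : ℤ → Prop} [DecidablePred P]
    (hK : K.card ≤ 5) (hU : U.card = 3) (hUY : U ⊆ Y) (hUP : ∀ u ∈ U, ¬P u)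
    (hP : ∀ p ∈ Y, P p → p ∉ K → -p ∈ Y ∧ ¬P (-p) ∧ -p ∉ U) :
    2 * (Y.filter P).card ≤ Y.card + 2 := by
  -- The antipodes of the elements with `P` outside `K`, together with `U`, are disjoint families of
  -- elements without `P`. With at most 5 exceptions against 3 extra failures, the excess in the
  -- bound is 2.
  have h1 : ((Y.filter P) \ K).card + U.card ≤ (Y.filter fun p => ¬P p).card := by
    rw [← Finset.card_image_of_injective ((Y.filter P) \ K) neg_injective,
      ← Finset.card_union_of_disjoint]
    · refine Finset.card_le_card fun q hq => ?_
      rw [Finset.mem_union, Finset.mem_image] at hq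
      rw [Finset.mem_filter]
      rcases hq with ⟨p, hp, rfl⟩ | hq
      · rw [Finset.mem_sdiff, Finset.mem_filter] at hp
        have := hP p hp.1.1 hp.1.2 hp.2
        exact ⟨this.1, this.2.1⟩
      · exact ⟨hUY hq, hUP q hq⟩
    · rw [Finset.disjoint_left]
      intro q hq hqU
      rw [Finset.mem_image] at hq
      obtain ⟨p, hp, rfl⟩ := hq
      rw [Finset.mem_sdiff, Finset.mem_filter] at hp
      exact (hP p hp.1.1 hp.1.2 hp.2).2.2 hqU
  have h2 := Finset.le_card_sdiff K (Y.filter P)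
  have h3 := Finset.card_filter_add_card_filter_not (s := Y) P
  omega

end Counting

/-! ### A removable pair of orbits -/

/-- `a` is the leftmost position of `X`, and `b` has the next larger value, `-a` ignored. -/
structure LeftPair (X : Finset ℤ) (w : ℤ → ℤ) (a b : ℤ) : Prop where
  config : SignedConfig X w
  left_mem : a ∈ X
  le : ∀ p ∈ X, a ≤ p
  up_mem : b ∈ X
  up_ne : b ≠ a
  up_ne_neg : b ≠ -a
  lt_up : w a < w b
  up_le : ∀ p ∈ X, p ≠ -a → w a < w p → w b ≤ w p

/-- Moreover `c` has the next smaller value, `-a` ignored, and lies to the left of `b`. -/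
structure LeftTriple (X : Finset ℤ) (w : ℤ → ℤ) (a b c : ℤ) : Prop extends LeftPair X w a b where
  down_mem : c ∈ X
  down_ne : c ≠ a
  down_ne_neg : c ≠ -a
  down_lt : w c < w a
  le_down : ∀ p ∈ X, p ≠ -a → w p < w a → w p ≤ w c
  down_lt_up : c < b

theorem mem_commonSeen {X : Finset ℤ} {w : ℤ → ℤ} {a c p : ℤ} :
    p ∈ commonSeen X w a c ↔
      p ∈ X ∧ p ≠ a ∧ p ≠ -a ∧ p ≠ c ∧ p ≠ -c ∧ Sees X w a p ∧ Sees X w c p := by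
  unfold commonSeen
  simp only [Finset.mem_filter, Finset.mem_sdiff, Finset.mem_insert, Finset.mem_singleton]
  tauto

theorem mem_commonUnseen {X : Finset ℤ} {w : ℤ → ℤ} {a c p : ℤ} :
    p ∈ commonUnseen X w a c ↔
      p ∈ X ∧ p ≠ a ∧ p ≠ -a ∧ p ≠ c ∧ p ≠ -c ∧ ¬Sees X w a p ∧ ¬Sees X w c p := by
  unfold commonUnseen
  simp only [Finset.mem_filter, Finset.mem_sdiff, Finset.mem_insert, Finset.mem_singleton]
  tauto

namespace LeftPair

variable {X : Finset ℤ} {w : ℤ → ℤ} {a b p q : ℤ}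

theorem lt_neg (H : LeftPair X w a b) (hp : p ∈ X) (h1 : p ≠ a) (h2 : p ≠ -a) :
    a < p ∧ p < -a := by
  have h3 := H.le p hp
  have h4 := H.le (-p) (H.config.neg_mem p hp)
  omega

/-- Otherwise `b` itself would lie in the rectangle from `a` to `p`. -/
theorem above (H : LeftPair X w a b) (hp : p ∈ commonSeen X w a b) (hlt : w a < w p) :
    w b < w p ∧ p < b := by
  obtain ⟨hX, h1, h2, h3, h4, hs, -⟩ := mem_commonSeen.1 hp
  have g1 := H.up_le p hX h2 hlt
  have g2 := H.config.map_ne hX H.up_mem h3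
  have g3 := (H.lt_neg H.up_mem H.up_ne H.up_ne_neg).1
  have g4 := H.up_ne_neg
  refine ⟨by omega, ?_⟩
  by_contra hb
  exact hs.false_of_lt H.up_mem g4 (by omega) g3 (by omega) H.lt_up (by omega)

/-- Take two such positions that are not antipodal. If they form an increasing pair, the first hides
the second from `a`; if a decreasing pair, the second hides the first from `b`. -/
theorem above_pair (H : LeftPair X w a b) (hp : p ∈ commonSeen X w a b) (hpw : w a < w p)
    (hq : q ∈ commonSeen X w a b) (hqw : w a < w q) : q = p ∨ q = -p := by
  have gp := H.above hp hpw
  have gq := H.above hq hqw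
  obtain ⟨hpX, h1, h2, h3, h4, hs, ht⟩ := mem_commonSeen.1 hp
  obtain ⟨hqX, h1', h2', h3', h4', hs', ht'⟩ := mem_commonSeen.1 hq
  have bp := H.lt_neg hpX h1 h2
  have bq := H.lt_neg hqX h1' h2'
  by_contra hne
  rw [not_or] at hne
  have hw := H.config.map_ne hpX hqX (Ne.symm hne.1)
  rcases lt_or_gt_of_ne hne.1 with hlt | hlt <;> rcases lt_or_gt_of_ne hw with hlt' | hlt'
  · exact ht'.symm.false_of_gt hpX (by omega) h4 hlt gp.2 hlt' gp.1
  · exact hs.false_of_lt hqX h2' hne.2 bq.1 hlt hqw hlt'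
  · exact hs'.false_of_lt hpX h2 (by omega) bp.1 hlt hpw hlt'
  · exact ht.symm.false_of_gt hqX hne.2 h4' hlt gq.2 hlt' gq.1

theorem card_commonSeen_le_two (H : LeftPair X w a b)
    (hmin : ∀ p ∈ X, p ≠ a → p ≠ -a → w a < w p) : (commonSeen X w a b).card ≤ 2 := by
  refine card_le_two_of_antipodal fun p hp q hq => ?_
  obtain ⟨hpX, h1, h2, -⟩ := mem_commonSeen.1 hp
  obtain ⟨hqX, h1', h2', -⟩ := mem_commonSeen.1 hq
  exact H.above_pair hp (hmin p hpX h1 h2) hq (hmin q hqX h1' h2')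

end LeftPair

namespace LeftTriple

variable {X : Finset ℤ} {w : ℤ → ℤ} {a b c p q : ℤ}

theorem value_cases (H : LeftTriple X w a b c) (hp : p ∈ X) (h1 : p ≠ a) (h2 : p ≠ -a) :
    w b ≤ w p ∨ w p ≤ w c := by
  have h3 := H.up_le p hp h2
  have h4 := H.le_down p hp h2
  have h5 := H.config.map_ne hp H.left_mem h1
  omega

/-- To the right of `c`, a lower position would be hidden from `a` by `c`. -/
theorem below (H : LeftTriple X w a b c) (hp : p ∈ commonSeen X w a b) (hlt : w p < w a)
    (hpc : p ≠ c) (hpc' : p ≠ -c) : p < c ∧ w p < w c := by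
  obtain ⟨hX, h1, h2, h3, h4, hs, ht⟩ := mem_commonSeen.1 hp
  have g1 := H.le_down p hX h2 hlt
  have g2 := H.config.map_ne hX H.down_mem hpc
  have g3 := H.lt_neg H.down_mem H.down_ne H.down_ne_neg
  refine ⟨?_, by omega⟩
  by_contra hb
  exact hs.false_of_gt H.down_mem H.down_ne_neg (by omega) g3.1 (by omega) H.down_lt (by omega)

/-- Since `w b = -w c > 0`, two antipodal positions cannot both lie above `b`, so `above_pair`
leaves one position there. Below, two positions would again hide one another from `a` or from `b`.
-/
theorem card_commonSeen_le_two (H : LeftTriple X w a b c) (hc : c = -b) :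
    (commonSeen X w a b).card ≤ 2 := by
  classical
  have hwc := H.config.odd b H.up_mem
  rw [← hc] at hwc
  have l1 := H.lt_up
  have l2 := H.down_lt
  have l3 := H.down_lt_up
  have hA : ((commonSeen X w a b).filter fun p => w a < w p).card ≤ 1 := by
    refine Finset.card_le_one.2 fun p hp q hq => ?_
    rw [Finset.mem_filter] at hp hq
    rcases H.above_pair hp.1 hp.2 hq.1 hq.2 with h | h
    · exact h.symm
    · exfalso
      have e1 := (H.above hp.1 hp.2).1
      have e2 := (H.above hq.1 hq.2).1
      rw [h, H.config.odd p (mem_commonSeen.1 hp.1).1] at e2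
      omega
  have hB : ((commonSeen X w a b).filter fun p => ¬w a < w p).card ≤ 1 := by
    refine Finset.card_le_one.2 fun p hp q hq => ?_
    rw [Finset.mem_filter] at hp hq
    obtain ⟨hpX, h1, h2, h3, h4, hs, ht⟩ := mem_commonSeen.1 hp.1
    obtain ⟨hqX, h1', h2', h3', h4', hs', ht'⟩ := mem_commonSeen.1 hq.1
    have np := H.config.map_ne hpX H.left_mem h1
    have nq := H.config.map_ne hqX H.left_mem h1'
    have gp := H.below hp.1 (by omega) (by omega) (by omega)
    have gq := H.below hq.1 (by omega) (by omega) (by omega)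
    have bp := H.lt_neg hpX h1 h2
    have bq := H.lt_neg hqX h1' h2'
    by_contra hne
    have hanti : q ≠ -p := by
      intro h
      rw [h, H.config.odd p hpX] at gq
      omega
    have hw := H.config.map_ne hpX hqX hne
    rcases lt_or_gt_of_ne hne with hlt | hlt <;> rcases lt_or_gt_of_ne hw with hlt' | hlt'
    · exact ht.symm.false_of_lt hqX hanti h4' hlt (by omega) hlt' (by omega)
    · exact hs'.false_of_gt hpX h2 (by omega) bp.1 hlt (by omega) hlt'
    · exact hs.false_of_gt hqX h2' hanti bq.1 hlt (by omega) hlt'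
    · exact ht'.symm.false_of_lt hpX (by omega) h4 hlt (by omega) hlt' (by omega)
  have := Finset.card_filter_add_card_filter_not (s := commonSeen X w a b) fun p => w a < w p
  omega

/-- Any other position would be left of and below `c`, and `c`, being left of `b`, would hide it
from `b`. If `c` were `-b`, it would not count as an obstruction. -/
theorem eq_of_below (H : LeftTriple X w a b c) (hc : c ≠ -b) (hp : p ∈ commonSeen X w a b)
    (hlt : w p < w a) : p = c ∨ p = -c := by
  by_contra hne
  rw [not_or] at hne
  have g := H.below hp hlt hne.1 hne.2
  obtain ⟨hX, h1, h2, h3, h4, hs, ht⟩ := mem_commonSeen.1 hp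
  have l1 := H.lt_up
  have l2 := H.down_lt
  exact ht.symm.false_of_lt H.down_mem (by omega) hc g.1 H.down_lt_up g.2 (by omega)

/-- The two ways in which removing `±a, ±b` can be too expensive. -/
theorem card_le_or (H : LeftTriple X w a b c) (hc : c ≠ -b) :
    (commonSeen X w a b).card ≤ 3 ∧
    ((commonSeen X w a b).card ≤ 2 ∨
    (c ∈ commonSeen X w a b ∧ -c ∈ commonSeen X w a b ∧ w (-c) < w a ∧
      ∃ d ∈ commonSeen X w a b, w a < w d) ∨
    (c ∈ commonSeen X w a b ∧ ∃ d ∈ commonSeen X w a b, -d ∈ commonSeen X w a b ∧ w a < w d ∧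
      w a < w (-d))) := by
  classical
  have l1 := H.lt_up
  have l2 := H.down_lt
  have hsum := Finset.card_filter_add_card_filter_not (s := commonSeen X w a b) fun p => w a < w p
  set A := (commonSeen X w a b).filter fun p => w a < w p with hA
  set B := (commonSeen X w a b).filter fun p => ¬w a < w p with hB
  have memA : ∀ p, p ∈ A ↔ p ∈ commonSeen X w a b ∧ w a < w p := fun p => Finset.mem_filter
  have memB : ∀ p, p ∈ B → p ∈ commonSeen X w a b ∧ w p < w a := by
    intro p hp
    rw [hB, Finset.mem_filter] at hp
    obtain ⟨hX, h1, -⟩ := mem_commonSeen.1 hp.1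
    have := H.config.map_ne hX H.left_mem h1
    exact ⟨hp.1, by omega⟩
  have hA2 : A.card ≤ 2 := card_le_two_of_antipodal fun p hp q hq =>
    H.above_pair ((memA p).1 hp).1 ((memA p).1 hp).2 ((memA q).1 hq).1 ((memA q).1 hq).2
  have hBsub : B ⊆ {c, -c} := by
    intro p hp
    simp only [Finset.mem_insert, Finset.mem_singleton]
    exact H.eq_of_below hc (memB p hp).1 (memB p hp).2
  have hB2 : B.card ≤ 2 := (Finset.card_le_card hBsub).trans Finset.card_le_two
  have wc := H.config.odd c H.down_mem
  by_cases hcB : -c ∈ B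
  · have hcB' := memB _ hcB
    -- Two antipodal positions above `b` would force `w b < 0`, hence `w c < 0`, and then `-c` could
    -- not lie below `a`.
    have hA1 : A.card ≤ 1 := by
      refine Finset.card_le_one.2 fun p hp q hq => ?_
      rw [memA] at hp hq
      rcases H.above_pair hp.1 hp.2 hq.1 hq.2 with h | h
      · exact h.symm
      · exfalso
        have e1 := (H.above hp.1 hp.2).1
        have e2 := (H.above hq.1 hq.2).1
        rw [h, H.config.odd p (mem_commonSeen.1 hp.1).1] at e2
        omega
    refine ⟨by omega, ?_⟩
    by_cases hcB2 : c ∈ B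
    · rcases A.eq_empty_or_nonempty with h0 | ⟨d, hd⟩
      · left
        rw [h0] at hsum
        simp only [Finset.card_empty] at hsum
        omega
      · exact Or.inr (Or.inl ⟨(memB _ hcB2).1, hcB'.1, hcB'.2, d, ((memA d).1 hd).1,
          ((memA d).1 hd).2⟩)
    · left
      have : B ⊆ {-c} := by
        intro p hp
        have := hBsub hp
        simp only [Finset.mem_insert, Finset.mem_singleton] at this ⊢
        rcases this with rfl | h
        · exact absurd hp hcB2
        · exact h
      have := Finset.card_le_card this
      simp only [Finset.card_singleton] at this
      omega
  · have hB1 : B ⊆ {c} := by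
      intro p hp
      have := hBsub hp
      simp only [Finset.mem_insert, Finset.mem_singleton] at this ⊢
      rcases this with h | rfl
      · exact h
      · exact absurd hp hcB
    have hB1' := Finset.card_le_card hB1
    simp only [Finset.card_singleton] at hB1'
    refine ⟨by omega, ?_⟩
    by_cases h3 : (commonSeen X w a b).card ≤ 2
    · exact Or.inl h3
    · right
      right
      obtain ⟨y, hy⟩ : B.Nonempty := Finset.card_pos.1 (by omega)
      have hyc := Finset.mem_singleton.1 (hB1 hy)
      obtain ⟨p, hp, q, hq, hpq⟩ := Finset.one_lt_card.1 (show 1 < A.card by omega)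
      rw [memA] at hp hq
      rcases H.above_pair hp.1 hp.2 hq.1 hq.2 with h | h
      · exact absurd h.symm hpq
      · rw [h] at hq
        exact ⟨hyc ▸ (memB y hy).1, p, hp.1, hq.1, hp.2, hq.2⟩

end LeftTriple

namespace LeftTriple

variable {X : Finset ℤ} {w : ℤ → ℤ} {a b c d p q : ℤ}

/-- The four named orbits have at most eight elements, so ten leave a fifth orbit; the sign is
chosen to make the value negative. -/
theorem exists_generic (H : LeftTriple X w a b c) (d : ℤ) (hcard : 10 ≤ X.card) :
    ∃ g ∈ X, g ≠ a ∧ g ≠ -a ∧ g ≠ b ∧ g ≠ -b ∧ g ≠ c ∧ g ≠ -c ∧ g ≠ d ∧ g ≠ -d ∧ w g < 0 := by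
  have hle : (({a, -a} ∪ {b, -b}) ∪ ({c, -c} ∪ {d, -d}) : Finset ℤ).card ≤ 8 := by
    have h2 : ∀ x y : ℤ, ({x, y} : Finset ℤ).card ≤ 2 := fun x y => Finset.card_le_two
    have e1 := Finset.card_union_le ({a, -a} ∪ {b, -b}) ({c, -c} ∪ {d, -d} : Finset ℤ)
    have e2 := Finset.card_union_le {a, -a} ({b, -b} : Finset ℤ)
    have e3 := Finset.card_union_le {c, -c} ({d, -d} : Finset ℤ)
    have := h2 a (-a)
    have := h2 b (-b)
    have := h2 c (-c)
    have := h2 d (-d)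
    omega
  obtain ⟨g, hg, hgn⟩ := Finset.exists_mem_notMem_of_card_lt_card
    (show (({a, -a} ∪ {b, -b}) ∪ ({c, -c} ∪ {d, -d}) : Finset ℤ).card < X.card by omega)
  simp only [Finset.mem_union, Finset.mem_insert, Finset.mem_singleton, not_or] at hgn
  have h0 := H.config.map_ne_zero hg
  have ho := H.config.odd g hg
  by_cases hlt : w g < 0
  · exact ⟨g, hg, by tauto⟩
  · exact ⟨-g, H.config.neg_mem g hg, by omega, by omega, by omega, by omega, by omega, by omega,
      by omega, by omega, by omega⟩

open Classical in
/-- Removing `±a, ±b` is too expensive because two antipodal positions above are seen by both. -/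
theorem exists_removable_of_antipodal (H : LeftTriple X w a b c)
    (hc : c ∈ commonSeen X w a b) (hd : d ∈ commonSeen X w a b) (hd' : -d ∈ commonSeen X w a b)
    (hwd : w a < w d) (hwd' : w a < w (-d)) (hpos : 0 < d) (hab : Sees X w a (-b))
    (hnone : commonUnseen X w a b = ∅) (hcard : 10 ≤ X.card) :
    (∃ q ∈ X, q ≠ a ∧ q ≠ -a ∧ (commonSeen X w a q).card + linkCount X w a q ≤
      4 + (commonUnseen X w a q).card) ∨
    2 * ((X \ {a, -a}).filter (Sees X w a)).card ≤ X.card := by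
  have C := H.config
  have l1 := H.lt_up
  have l2 := H.down_lt
  have l3 := H.down_lt_up
  obtain ⟨ab1, ab2⟩ := H.above hd hwd
  obtain ⟨ab3, ab4⟩ := H.above hd' hwd'
  obtain ⟨cX, ca, ca', cb, cb', sac, sbc⟩ := mem_commonSeen.1 hc
  obtain ⟨dX, da, da', db, db', sad, sbd⟩ := mem_commonSeen.1 hd
  obtain ⟨-, -, -, -, -, sad', sbd'⟩ := mem_commonSeen.1 hd'
  have bX := H.up_mem
  have ba := H.up_ne
  have ba' := H.up_ne_neg
  have wb := C.odd b bX
  have wc := C.odd c cX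
  have wd := C.odd d dX
  have bb := H.lt_neg bX ba ba'
  have bc := H.lt_neg cX ca ca'
  have bd := H.lt_neg dX da da'
  have cd : c ≠ d := fun h => by rw [h] at l2; omega
  have cd' : c ≠ -d := fun h => by rw [h] at l2; omega
  -- `-b` stands in the way, since `c < b` and `w c < w b < 0`.
  have nac : ¬Sees X w a (-c) := fun h =>
    h.false_of_lt (C.neg_mem b bX) (by omega) (by omega) (by omega) (by omega) (by omega) (by omega)
  have sees_b : ∀ p ∈ X, p ≠ a → p ≠ -a → p ≠ b → p ≠ -b → ¬Sees X w a p → Sees X w b p := by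
    intro p hp h1 h2 h3 h4 h5
    by_contra h6
    have : p ∈ commonUnseen X w a b := mem_commonUnseen.2 ⟨hp, h1, h2, h3, h4, h5, h6⟩
    rw [hnone] at this
    exact absurd this (Finset.notMem_empty p)
  -- As `a` does not see `-c`, `b` must see it; otherwise `d` would hide it.
  have hcd : c < -d := by
    by_contra hlt
    have hs := sees_b (-c) (C.neg_mem c cX) (by omega) (by omega) (by omega) (by omega) nac
    exact hs.symm.false_of_gt dX (by omega) db' (by omega) ab2 (by omega) ab1
  have inner : ∀ p ∈ X, p ≠ a → p ≠ -a → p ≠ b → p ≠ -b → p ≠ d → p ≠ -d → w b < w p →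
      w p < -w b → -b < p := by
    intro p hp h1 h2 h3 h4 h5 h6 h7 h8
    have bp := H.lt_neg hp h1 h2
    by_contra hlt
    exact hab.false_of_lt hp h2 (by omega) bp.1 (by omega) (by omega) (by omega)
  have inner2 : ∀ p ∈ X, p ≠ a → p ≠ -a → p ≠ b → p ≠ -b → p ≠ d → p ≠ -d → w b < w p →
      p < b → ∀ e ∈ X, e ≠ a → e ≠ -a → p ≠ e → p ≠ -e → e < b → Sees X w a e → Sees X w b e →
        w e < w p := by
    intro p hp h1 h2 h3 h4 h5 h6 h7 h8 e eX ea ea' pe pe' heb h9 h10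
    have bp := H.lt_neg hp h1 h2
    have hne := C.map_ne hp eX pe
    by_contra hlt
    rcases lt_or_gt_of_ne pe with h | h
    · exact h9.false_of_lt hp h2 pe' bp.1 h (by omega) (by omega)
    · exact h10.symm.false_of_gt hp pe' h4 h h8 (by omega) h7
  -- A further value of modulus below `-w b` would put both `p` and `-p` strictly between `-b` and
  -- `b`, with `w d < w p` and `w (-d) < w (-p)`, a contradiction.
  have generic : ∀ p ∈ X, p ≠ a → p ≠ -a → p ≠ b → p ≠ -b → p ≠ c → p ≠ -c → p ≠ d → p ≠ -d →
      w p < w c ∨ -w c < w p := by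
    intro p hp h1 h2 h3 h4 h5 h6 h7 h8
    have hn := C.neg_mem p hp
    have wp := C.odd p hp
    have v1 := H.value_cases hp h1 h2
    have v2 := H.value_cases hn (by omega) (by omega)
    have n1 := C.map_ne hp cX h5
    have n2 := C.map_ne hn cX (by omega)
    have n3 := C.map_ne hp bX h3
    have n4 := C.map_ne hn bX (by omega)
    by_contra hcon
    rw [not_or] at hcon
    have i1 := inner p hp h1 h2 h3 h4 h7 h8 (by omega) (by omega)
    have i2 := inner (-p) hn (by omega) (by omega) (by omega) (by omega) (by omega) (by omega)
      (by omega) (by omega)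
    have j1 := inner2 p hp h1 h2 h3 h4 h7 h8 (by omega) (by omega) d dX da da' h7 h8 ab2 sad sbd
    have j2 := inner2 (-p) hn (by omega) (by omega) (by omega) (by omega) (by omega) (by omega)
      (by omega) (by omega) (-d) (C.neg_mem d dX) (by omega) (by omega) (by omega) (by omega)
      (by omega) sad' sbd'
    omega
  -- Lower positions are hidden from `a` by `c` unless left of it, and their antipodes by `-b`
  -- unless left of that. As `c < b`, at most one of `p`, `-p` is seen.
  have far : ∀ p ∈ X, p ≠ a → p ≠ -a → p ≠ b → p ≠ -b → p ≠ c → p ≠ -c → w p < w c →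
      (Sees X w a p → p < c) ∧ (Sees X w a (-p) → b < p) := by
    intro p hp h1 h2 h3 h4 h5 h6 h7
    have wp := C.odd p hp
    constructor
    · intro hs
      by_contra hlt
      exact hs.false_of_gt cX (by omega) (by omega) bc.1 (by omega) (by omega) (by omega)
    · intro hs
      by_contra hlt
      exact hs.false_of_lt (C.neg_mem b bX) (by omega) (by omega) (by omega) (by omega) (by omega)
        (by omega)
  have hthree : (commonSeen X w a d).card ≤ 3 := by
    have hA : ((commonSeen X w a d).filter fun p => w a < w p) ⊆ {b, -b} := by
      intro p hp
      rw [Finset.mem_filter] at hp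
      obtain ⟨hp, hlt⟩ := hp
      obtain ⟨pX, h1, h2, h3, h4, hs, ht⟩ := mem_commonSeen.1 hp
      simp only [Finset.mem_insert, Finset.mem_singleton]
      by_contra hne
      rw [not_or] at hne
      have h5 : p ≠ c := fun h => by rw [h] at hlt; omega
      have h6 : p ≠ -c := fun h => nac (h ▸ hs)
      have h7 := generic p pX h1 h2 hne.1 hne.2 h5 h6 h3 h4
      have h8 : p < -b := by
        by_contra hge
        exact hs.false_of_lt (C.neg_mem b bX) (by omega) (by omega) (by omega) (by omega) (by omega)
          (by omega)
      exact ht.symm.false_of_gt (C.neg_mem b bX) (by omega) (by omega) h8 (by omega) (by omega)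
        (by omega)
    have hB : ((commonSeen X w a d).filter fun p => ¬w a < w p).card ≤ 1 := by
      have hleft : ∀ p ∈ commonSeen X w a d, ¬w a < w p →
          w p < w a ∧ p < d := by
        intro p hp hlt
        obtain ⟨pX, h1, h2, h3, h4, hs, ht⟩ := mem_commonSeen.1 hp
        have n1 := C.map_ne pX H.left_mem h1
        refine ⟨by omega, ?_⟩
        by_contra hge
        have n2 := C.map_ne pX cX (by omega)
        have h5 := H.le_down p pX h2 (by omega)
        exact hs.false_of_gt cX (by omega)
          (fun h => nac (by rw [h, neg_neg]; exact hs)) bc.1 (by omega) (by omega) (by omega)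
      refine Finset.card_le_one.2 fun p hp q hq => ?_
      rw [Finset.mem_filter] at hp hq
      have gp := hleft p hp.1 hp.2
      have gq := hleft q hq.1 hq.2
      obtain ⟨pX, h1, h2, h3, h4, hs, ht⟩ := mem_commonSeen.1 hp.1
      obtain ⟨qX, h1', h2', h3', h4', hs', ht'⟩ := mem_commonSeen.1 hq.1
      have bp := H.lt_neg pX h1 h2
      have bq := H.lt_neg qX h1' h2'
      by_contra hne
      have hanti : q ≠ -p := by
        intro h
        rw [h, C.odd p pX] at gq
        omega
      have hw := C.map_ne pX qX hne
      rcases lt_or_gt_of_ne hne with hlt | hlt <;> rcases lt_or_gt_of_ne hw with hlt' | hlt'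
      · exact ht.symm.false_of_lt qX hanti h4' hlt gq.2 hlt' (by omega)
      · exact hs'.false_of_gt pX h2 (by omega) bp.1 hlt gp.1 hlt'
      · exact hs.false_of_gt qX h2' hanti bq.1 hlt gq.1 hlt'
      · exact ht'.symm.false_of_lt pX (by omega) h4 hlt gp.2 hlt' (by omega)
    have h1 := (Finset.card_le_card hA).trans Finset.card_le_two
    have h2 := Finset.card_filter_add_card_filter_not (s := commonSeen X w a d) fun p => w a < w p
    omega
  -- The pair `a, d` now costs at most 5, so one position unseen by both makes it removable. If `a`
  -- sees one of `g`, `-g`, the other is such a position; if `a` sees neither, the antipodal count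
  -- applies.
  have hlink := linkCount_le X w a d
  obtain ⟨g, gX, ga, ga', gb, gb', gc, gc', gd, gd', wg0⟩ := H.exists_generic d hcard
  have wg := C.odd g gX
  have wgc : w g < w c := by
    have := generic g gX ga ga' gb gb' gc gc' gd gd'
    omega
  have hfar := far g gX ga ga' gb gb' gc gc' wgc
  by_cases h1 : Sees X w a g
  · left
    have hgc := hfar.1 h1
    have : -g ∈ commonUnseen X w a d := by
      refine mem_commonUnseen.2 ⟨C.neg_mem g gX, by omega, by omega, by omega, by omega,
        fun hs => by have := hfar.2 hs; omega, fun hs => ?_⟩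
      exact hs.false_of_lt (C.neg_mem c cX) (by omega) (by omega) (by omega) (by omega) (by omega)
        (by omega)
    have := Finset.card_pos.2 ⟨_, this⟩
    exact ⟨d, dX, da, da', by omega⟩
  by_cases h2 : Sees X w a (-g)
  · left
    have hgc := hfar.2 h2
    have : g ∈ commonUnseen X w a d := by
      refine mem_commonUnseen.2 ⟨gX, ga, ga', gd, gd', h1, fun hs => ?_⟩
      exact hs.false_of_gt bX (by omega) (by omega) (by omega) (by omega) (by omega) (by omega)
    have := Finset.card_pos.2 ⟨_, this⟩
    exact ⟨d, dX, da, da', by omega⟩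
  · right
    have g0 := C.ne_zero g gX
    have := card_filter_le_of_antipodal (Y := X \ {a, -a}) (K := {b, -b, c, d, -d})
      (U := {-c, g, -g}) (P := Sees X w a) Finset.card_le_five
      (Finset.card_eq_three.2 ⟨-c, g, -g, by omega, by omega, by omega, rfl⟩) (by
        intro u hu
        simp only [Finset.mem_sdiff, Finset.mem_insert, Finset.mem_singleton] at hu ⊢
        rcases hu with rfl | rfl | rfl
        · exact ⟨C.neg_mem c cX, by omega⟩
        · exact ⟨gX, by omega⟩
        · exact ⟨C.neg_mem g gX, by omega⟩) (by
        intro u hu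
        simp only [Finset.mem_insert, Finset.mem_singleton] at hu
        rcases hu with rfl | rfl | rfl
        · exact nac
        · exact h1
        · exact h2) (by
        intro p hp hs hK
        simp only [Finset.mem_sdiff, Finset.mem_insert, Finset.mem_singleton, not_or] at hp hK ⊢
        obtain ⟨pX, pa, pa'⟩ := hp
        obtain ⟨pb, pb', pc, pd, pd'⟩ := hK
        have pc' : p ≠ -c := fun h => nac (h ▸ hs)
        have pg : p ≠ g := fun h => h1 (h ▸ hs)
        have pg' : p ≠ -g := fun h => h2 (h ▸ hs)
        have nX := C.neg_mem p pX
        have wp := C.odd p pX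
        refine ⟨⟨nX, by omega, by omega⟩, fun hs' => ?_, by omega, by omega, by omega⟩
        rcases generic p pX pa pa' pb pb' pc pc' pd pd' with h | h
        · have := far p pX pa pa' pb pb' pc pc' h
          have := this.1 hs
          have := (far p pX pa pa' pb pb' pc pc' h).2 hs'
          omega
        · have := far (-p) nX (by omega) (by omega) (by omega) (by omega) (by omega) (by omega)
            (by omega)
          rw [neg_neg] at this
          have e1 := this.1 hs'
          have e2 := this.2 hs
          omega)
    have := C.card_sdiff_pair H.left_mem
    omega

open Classical in
/-- Removing `±a, ±b` is too expensive because both `c` and `-c` are seen by both. -/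
theorem exists_removable_of_below (H : LeftTriple X w a b c)
    (hc : c ∈ commonSeen X w a b) (hc' : -c ∈ commonSeen X w a b) (hwc : w (-c) < w a)
    (hd : d ∈ commonSeen X w a b) (hwd : w a < w d) (hab : Sees X w a (-b))
    (hnone : commonUnseen X w a b = ∅) (hcard : 10 ≤ X.card) :
    (∃ q ∈ X, q ≠ a ∧ q ≠ -a ∧ (commonSeen X w a q).card + linkCount X w a q ≤
      4 + (commonUnseen X w a q).card) ∨
    2 * ((X \ {a, -a}).filter (Sees X w a)).card ≤ X.card := by
  have C := H.config
  have l1 := H.lt_up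
  have l2 := H.down_lt
  have l3 := H.down_lt_up
  obtain ⟨ab1, ab2⟩ := H.above hd hwd
  obtain ⟨cX, ca, ca', cb, cb', sac, sbc⟩ := mem_commonSeen.1 hc
  obtain ⟨-, -, -, -, -, sac', sbc'⟩ := mem_commonSeen.1 hc'
  obtain ⟨dX, da, da', db, db', sad, sbd⟩ := mem_commonSeen.1 hd
  have bX := H.up_mem
  have ba := H.up_ne
  have ba' := H.up_ne_neg
  have wb := C.odd b bX
  have wc := C.odd c cX
  have wd := C.odd d dX
  have bb := H.lt_neg bX ba ba'
  have bc := H.lt_neg cX ca ca'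
  have bd := H.lt_neg dX da da'
  have c0 := C.map_ne_zero cX
  have cpos : 0 < w c := by
    have := H.le_down (-c) (C.neg_mem c cX) (by omega) hwc
    omega
  have cd : c ≠ d := fun h => by rw [h] at l2; omega
  have cd' : c ≠ -d := fun h => by rw [h] at cpos; omega
  -- Otherwise `c` would hide `-b` from `a`.
  have hbc : -b < c := by
    by_contra hlt
    exact hab.false_of_gt cX (by omega) (by omega) bc.1 (by omega) (by omega) (by omega)
  have nad : ¬Sees X w a (-d) := fun h =>
    h.false_of_gt (C.neg_mem b bX) (by omega) (by omega) (by omega) (by omega) (by omega) (by omega)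
  have sees_b : ∀ p ∈ X, p ≠ a → p ≠ -a → p ≠ b → p ≠ -b → ¬Sees X w a p → Sees X w b p := by
    intro p hp h1 h2 h3 h4 h5
    by_contra h6
    have : p ∈ commonUnseen X w a b := mem_commonUnseen.2 ⟨hp, h1, h2, h3, h4, h5, h6⟩
    rw [hnone] at this
    exact absurd this (Finset.notMem_empty p)
  -- `b` must see `-d`, because `a` does not; neither `c` nor `-c` may stand in between.
  have hdc : d < c ∧ d < -c := by
    have hs := sees_b (-d) (C.neg_mem d dX) (by omega) (by omega) (by omega) (by omega) nad
    constructor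
    · by_contra hlt
      exact hs.symm.false_of_lt (C.neg_mem c cX) (by omega) (by omega) (by omega) (by omega)
        (by omega) (by omega)
    · by_contra hlt
      exact hs.symm.false_of_lt cX (by omega) (by omega) (by omega) (by omega)
        (by omega) (by omega)
  have inner : ∀ p ∈ X, p ≠ a → p ≠ -a → p ≠ b → p ≠ -b → p ≠ c → p ≠ -c → w p < w c →
      -w c < w p → b < p := by
    intro p hp h1 h2 h3 h4 h5 h6 h7 h8
    have bp := H.lt_neg hp h1 h2
    by_contra hlt
    rcases lt_or_gt_of_ne h6 with h | h
    · exact sac'.false_of_gt hp h2 (by omega) bp.1 h (by omega) (by omega)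
    · exact sbc'.symm.false_of_lt hp (by omega) h4 h (by omega) (by omega) (by omega)
  -- A further value of modulus below `w b` has modulus below `w c`; since `-c` is seen by `a` and
  -- `b`, this puts both `p` and `-p` to the right of `b > 0`.
  have generic : ∀ p ∈ X, p ≠ a → p ≠ -a → p ≠ b → p ≠ -b → p ≠ c → p ≠ -c →
      w p < -w b ∨ w b < w p := by
    intro p hp h1 h2 h3 h4 h5 h6
    have hn := C.neg_mem p hp
    have wp := C.odd p hp
    have v1 := H.value_cases hp h1 h2
    have v2 := H.value_cases hn (by omega) (by omega)
    have n1 := C.map_ne hp cX h5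
    have n2 := C.map_ne hn cX (by omega)
    have n3 := C.map_ne hp bX h3
    have n4 := C.map_ne hn bX (by omega)
    by_contra hcon
    rw [not_or] at hcon
    have i1 := inner p hp h1 h2 h3 h4 h5 h6 (by omega) (by omega)
    have i2 := inner (-p) hn (by omega) (by omega) (by omega) (by omega) (by omega) (by omega)
      (by omega) (by omega)
    omega
  have far : ∀ p ∈ X, p ≠ a → p ≠ -a → p ≠ b → p ≠ -b → w p < -w b →
      (Sees X w a p → p < -b) ∧ (Sees X w a (-p) → -p < b) := by
    intro p hp h1 h2 h3 h4 h7
    have wp := C.odd p hp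
    constructor
    · intro hs
      by_contra hlt
      exact hs.false_of_gt (C.neg_mem b bX) (by omega) (by omega) (by omega) (by omega) (by omega)
        (by omega)
    · intro hs
      by_contra hlt
      exact hs.false_of_lt bX (by omega) (by omega) (by omega) (by omega) (by omega)
        (by omega)
  have upper : ∀ p ∈ X, p ≠ a → p ≠ -a → p ≠ b → p ≠ -b → p ≠ d → p ≠ -d → w b < w p → p < b →
      Sees X w a p → p < d ∧ w d < w p := by
    intro p pX h1 h2 h3 h4 h5 h6 h7 h8 hs
    have bp := H.lt_neg pX h1 h2
    have hw := C.map_ne pX dX h5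
    rcases lt_or_gt_of_ne h5 with h | h
    · refine ⟨h, ?_⟩
      by_contra hlt
      exact sad.false_of_lt pX h2 h6 bp.1 h (by omega) (by omega)
    · exfalso
      rcases lt_or_gt_of_ne hw with hlt | hlt
      · exact sbd.symm.false_of_gt pX (by omega) h4 h h8 hlt h7
      · exact hs.false_of_lt dX da' (by omega) bd.1 h hwd hlt
  have hthree : (commonSeen X w a c).card ≤ 3 := by
    have hA : ((commonSeen X w a c).filter fun p => w a < w p) ⊆ {b, d} := by
      intro p hp
      rw [Finset.mem_filter] at hp
      obtain ⟨hp, hlt⟩ := hp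
      obtain ⟨pX, h1, h2, h3, h4, hs, ht⟩ := mem_commonSeen.1 hp
      simp only [Finset.mem_insert, Finset.mem_singleton]
      by_contra hne
      rw [not_or] at hne
      have h5 : p ≠ -b := fun h => by rw [h] at hlt; omega
      have h6 : p ≠ -d := fun h => nad (h ▸ hs)
      have h7 := generic p pX h1 h2 hne.1 h5 h3 h4
      have h8 : p < b := by
        by_contra hge
        exact hs.false_of_lt bX (by omega) (by omega) (by omega) (by omega) (by omega)
          (by omega)
      have h9 := upper p pX h1 h2 hne.1 h5 hne.2 h6 (by omega) h8 hs
      exact ht.symm.false_of_gt dX (by omega) (by omega) h9.1 hdc.1 h9.2 (by omega)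
    have hB : ((commonSeen X w a c).filter fun p => ¬w a < w p).card ≤ 1 := by
      have hleft : ∀ p ∈ commonSeen X w a c, ¬w a < w p → w p < 0 ∧ w p < w c ∧ p < c := by
        intro p hp hlt
        obtain ⟨pX, h1, h2, h3, h4, hs, ht⟩ := mem_commonSeen.1 hp
        have n1 := C.map_ne pX H.left_mem h1
        have n2 := C.map_ne pX cX h3
        have h5 := H.le_down p pX h2 (by omega)
        have h6 : w p < 0 := by
          by_cases h7 : p = -b
          · rw [h7]
            omega
          · by_cases h8 : p = b
            · rw [h8] at hlt
              omega
            · have := generic p pX h1 h2 h8 h7 h3 h4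
              omega
        refine ⟨h6, by omega, ?_⟩
        by_contra hge
        exact hs.false_of_gt cX (by omega) (by omega) bc.1 (by omega) (by omega) (by omega)
      refine Finset.card_le_one.2 fun p hp q hq => ?_
      rw [Finset.mem_filter] at hp hq
      have gp := hleft p hp.1 hp.2
      have gq := hleft q hq.1 hq.2
      obtain ⟨pX, h1, h2, h3, h4, hs, ht⟩ := mem_commonSeen.1 hp.1
      obtain ⟨qX, h1', h2', h3', h4', hs', ht'⟩ := mem_commonSeen.1 hq.1
      have bp := H.lt_neg pX h1 h2
      have bq := H.lt_neg qX h1' h2'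
      by_contra hne
      have hanti : q ≠ -p := by
        intro h
        rw [h, C.odd p pX] at gq
        omega
      have hw := C.map_ne pX qX hne
      rcases lt_or_gt_of_ne hne with hlt | hlt <;> rcases lt_or_gt_of_ne hw with hlt' | hlt'
      · exact ht.symm.false_of_lt qX hanti h4' hlt gq.2.2 hlt' gq.2.1
      · exact hs'.false_of_gt pX h2 (by omega) bp.1 hlt (by omega) hlt'
      · exact hs.false_of_gt qX h2' hanti bq.1 hlt (by omega) hlt'
      · exact ht'.symm.false_of_lt pX (by omega) h4 hlt gp.2.2 hlt' gp.2.1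
    have h1 := (Finset.card_le_card hA).trans Finset.card_le_two
    have h2 := Finset.card_filter_add_card_filter_not (s := commonSeen X w a c) fun p => w a < w p
    omega
  -- As in the antipodal case, with `c` as the partner of `a` and with `b` and `-d` as the
  -- obstructions for `-g` and `g`.
  have hlink := linkCount_le X w a c
  obtain ⟨g, gX, ga, ga', gb, gb', gc, gc', gd, gd', wg0⟩ := H.exists_generic d hcard
  have wg := C.odd g gX
  have wgc : w g < -w b := by
    have := generic g gX ga ga' gb gb' gc gc'
    omega
  have hfar := far g gX ga ga' gb gb' wgc
  by_cases h1 : Sees X w a g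
  · left
    have hgc := hfar.1 h1
    have : -g ∈ commonUnseen X w a c := by
      refine mem_commonUnseen.2 ⟨C.neg_mem g gX, by omega, by omega, by omega, by omega,
        fun hs => by have := hfar.2 hs; omega, fun hs => ?_⟩
      exact hs.false_of_lt bX (by omega) (by omega) (by omega) (by omega) (by omega)
        (by omega)
    have := Finset.card_pos.2 ⟨_, this⟩
    exact ⟨c, cX, ca, ca', by omega⟩
  by_cases h2 : Sees X w a (-g)
  · left
    have hgc := hfar.2 h2
    have hup := upper (-g) (C.neg_mem g gX) (by omega) (by omega) (by omega) (by omega) (by omega)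
      (by omega) (by omega) hgc h2
    have : g ∈ commonUnseen X w a c := by
      refine mem_commonUnseen.2 ⟨gX, ga, ga', gc, gc', h1, fun hs => ?_⟩
      exact hs.false_of_gt (C.neg_mem d dX) (by omega) (by omega) (by omega) (by omega) (by omega)
        (by omega)
    have := Finset.card_pos.2 ⟨_, this⟩
    exact ⟨c, cX, ca, ca', by omega⟩
  · right
    have g0 := C.ne_zero g gX
    have := card_filter_le_of_antipodal (Y := X \ {a, -a}) (K := {b, -b, c, -c, d})
      (U := {-d, g, -g}) (P := Sees X w a) Finset.card_le_five
      (Finset.card_eq_three.2 ⟨-d, g, -g, by omega, by omega, by omega, rfl⟩) (by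
        intro u hu
        simp only [Finset.mem_sdiff, Finset.mem_insert, Finset.mem_singleton] at hu ⊢
        rcases hu with rfl | rfl | rfl
        · exact ⟨C.neg_mem d dX, by omega⟩
        · exact ⟨gX, by omega⟩
        · exact ⟨C.neg_mem g gX, by omega⟩) (by
        intro u hu
        simp only [Finset.mem_insert, Finset.mem_singleton] at hu
        rcases hu with rfl | rfl | rfl
        · exact nad
        · exact h1
        · exact h2) (by
        intro p hp hs hK
        simp only [Finset.mem_sdiff, Finset.mem_insert, Finset.mem_singleton, not_or] at hp hK ⊢
        obtain ⟨pX, pa, pa'⟩ := hp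
        obtain ⟨pb, pb', pc, pc', pd⟩ := hK
        have pd' : p ≠ -d := fun h => nad (h ▸ hs)
        have pg : p ≠ g := fun h => h1 (h ▸ hs)
        have pg' : p ≠ -g := fun h => h2 (h ▸ hs)
        have nX := C.neg_mem p pX
        have wp := C.odd p pX
        refine ⟨⟨nX, by omega, by omega⟩, fun hs' => ?_, by omega, by omega, by omega⟩
        rcases generic p pX pa pa' pb pb' pc pc' with h | h
        · have e1 := (far p pX pa pa' pb pb' h).1 hs
          have e2 := (far p pX pa pa' pb pb' h).2 hs'
          omega
        · have := far (-p) nX (by omega) (by omega) (by omega) (by omega) (by omega)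
          rw [neg_neg] at this
          have e1 := this.1 hs'
          have e2 := this.2 hs
          omega)
    have := C.card_sdiff_pair H.left_mem
    omega

end LeftTriple

/-! ### The inductive bound on the number of visible pairs -/

section Bound

variable {X : Finset ℤ} {w : ℤ → ℤ} {a b c : ℤ}

open Classical in
/-- Some one or two orbits of `X` can be removed at the cost allowed in the induction. -/
def HasRemovable (X : Finset ℤ) (w : ℤ → ℤ) : Prop :=
  ∃ a ∈ X, (∃ q ∈ X, q ≠ a ∧ q ≠ -a ∧ (commonSeen X w a q).card + linkCount X w a q ≤
      4 + (commonUnseen X w a q).card) ∨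
    2 * ((X \ {a, -a}).filter (Sees X w a)).card ≤ X.card ∨
    (X.card < 10 ∧ ∃ q ∈ X, q ≠ a ∧ q ≠ -a ∧ (commonSeen X w a q).card + linkCount X w a q ≤ 5)

theorem LeftTriple.hasRemovable (H : LeftTriple X w a b c) : HasRemovable X w := by
  have hlink := linkCount_le X w a b
  by_cases hcb : c = -b
  · have := H.card_commonSeen_le_two hcb
    exact ⟨a, H.left_mem, Or.inl ⟨b, H.up_mem, H.up_ne, H.up_ne_neg, by omega⟩⟩
  · obtain ⟨h3, hcases⟩ := H.card_le_or hcb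
    by_cases hgood : (commonSeen X w a b).card + linkCount X w a b ≤
        4 + (commonUnseen X w a b).card
    · exact ⟨a, H.left_mem, Or.inl ⟨b, H.up_mem, H.up_ne, H.up_ne_neg, hgood⟩⟩
    by_cases hcard : X.card < 10
    · exact ⟨a, H.left_mem, Or.inr (Or.inr
        ⟨hcard, b, H.up_mem, H.up_ne, H.up_ne_neg, by omega⟩)⟩
    -- At most 3 common positions and at most 2 links exceed `4 + #unseen` only if both bounds are
    -- attained and no position is unseen by both.
    have hnone : commonUnseen X w a b = ∅ := Finset.card_eq_zero.1 (by omega)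
    have hab : Sees X w a (-b) := sees_of_linkCount (by omega)
    refine ⟨a, H.left_mem, ?_⟩
    rw [← or_assoc]
    left
    rcases hcases with h | ⟨hc, hc', hwc, d, hd, hwd⟩ | ⟨hc, d, hd, hd', hwd, hwd'⟩
    · omega
    · exact H.exists_removable_of_below hc hc' hwc hd hwd hab hnone (by omega)
    · have hd0 := H.config.ne_zero d (mem_commonSeen.1 hd).1
      rcases lt_or_gt_of_ne hd0 with h | h
      · exact H.exists_removable_of_antipodal hc hd' (by rwa [neg_neg]) hwd' (by rwa [neg_neg])
          (by omega) hab hnone (by omega)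
      · exact H.exists_removable_of_antipodal hc hd hd' hwd hwd' h hab hnone (by omega)

theorem exists_leftPair (hX : SignedConfig X w) (ha : a ∈ X) (hle : ∀ p ∈ X, a ≤ p)
    (hex : ∃ p ∈ X, p ≠ a ∧ p ≠ -a ∧ w a < w p) : ∃ b, LeftPair X w a b := by
  obtain ⟨p, hp, h1, h2, h3⟩ := hex
  obtain ⟨b, hb, hmin⟩ := Finset.exists_min_image
    (X.filter fun p => p ≠ a ∧ p ≠ -a ∧ w a < w p) w ⟨p, Finset.mem_filter.2 ⟨hp, h1, h2, h3⟩⟩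
  rw [Finset.mem_filter] at hb
  refine ⟨b, hX, ha, hle, hb.1, hb.2.1, hb.2.2.1, hb.2.2.2, fun q hq h4 h5 => ?_⟩
  refine hmin q (Finset.mem_filter.2 ⟨hq, ?_, h4, h5⟩)
  rintro rfl
  omega

theorem hasRemovable_of_bottom (hX : SignedConfig X w) (ha : a ∈ X) (hle : ∀ p ∈ X, a ≤ p)
    (hmin : ∀ p ∈ X, p ≠ a → p ≠ -a → w a < w p) (hcard : 4 ≤ X.card) : HasRemovable X w := by
  have h1 := hX.card_sdiff_pair ha
  obtain ⟨p, hp⟩ : (X \ {a, -a}).Nonempty := Finset.card_pos.1 (by omega)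
  simp only [Finset.mem_sdiff, Finset.mem_insert, Finset.mem_singleton, not_or] at hp
  obtain ⟨b, H⟩ := exists_leftPair hX ha hle
    ⟨p, hp.1, hp.2.1, hp.2.2, hmin p hp.1 hp.2.1 hp.2.2⟩
  have h2 := H.card_commonSeen_le_two hmin
  have h3 := linkCount_le X w a b
  exact ⟨a, ha, Or.inl ⟨b, H.up_mem, H.up_ne, H.up_ne_neg, by omega⟩⟩

/-- Negating all values preserves visibility and exchanges the roles of `b` and `c`, so their
left-to-right order may be prescribed. -/
theorem hasRemovable_or_flip (hX : SignedConfig X w) (hcard : 4 ≤ X.card) :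
    HasRemovable X w ∨ HasRemovable X (fun x => -w x) := by
  have hne : X.Nonempty := Finset.card_pos.1 (by omega)
  obtain ⟨a, ha, hle⟩ : ∃ a ∈ X, ∀ p ∈ X, a ≤ p :=
    ⟨X.min' hne, X.min'_mem hne, fun p hp => X.min'_le p hp⟩
  by_cases hD : ∃ p ∈ X, p ≠ a ∧ p ≠ -a ∧ w p < w a
  · by_cases hU : ∃ p ∈ X, p ≠ a ∧ p ≠ -a ∧ w a < w p
    · obtain ⟨b, Hb⟩ := exists_leftPair hX ha hle hU
      obtain ⟨c, Hc⟩ := exists_leftPair (w := fun x => -w x) hX.flip ha hle (by simpa using hD)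
      have hbc : b ≠ c := by
        rintro rfl
        have h1 := Hb.lt_up
        have h2 := Hc.lt_up
        omega
      have hlc := Hc.lt_up
      have hlb := Hb.lt_up
      rcases lt_or_gt_of_ne hbc with h | h
      · right
        exact LeftTriple.hasRemovable (a := a) (b := c) (c := b)
          ⟨Hc, Hb.up_mem, Hb.up_ne, Hb.up_ne_neg, by simpa using hlb,
            fun p hp h1 h2 => by simpa using Hb.up_le p hp h1 (by simpa using h2), h⟩
      · left
        exact LeftTriple.hasRemovable (a := a) (b := b) (c := c)
          ⟨Hb, Hc.up_mem, Hc.up_ne, Hc.up_ne_neg, by omega,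
            fun p hp h1 h2 => by simpa using Hc.up_le p hp h1 (by simpa using h2), h⟩
    · right
      refine hasRemovable_of_bottom hX.flip ha hle (fun p hp h1 h2 => ?_) hcard
      by_contra h3
      have h4 := hX.map_ne hp ha h1
      exact hU ⟨p, hp, h1, h2, by omega⟩
  · left
    refine hasRemovable_of_bottom hX ha hle (fun p hp h1 h2 => ?_) hcard
    by_contra h3
    have h4 := hX.map_ne hp ha h1
    exact hD ⟨p, hp, h1, h2, by omega⟩

/-- With `f n = 2n² + 4n - 4`, `f (m + 2) - f m = 4 * (2m) + 16` explains the allowance 4 for two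
orbits, and `f (m + 1) - f m = 4m + 6` pays for an `a` seeing at most half of the configuration. -/
theorem visiblePairs_bound (n : ℕ) (hn : 1 ≤ n) (X : Finset ℤ) (w : ℤ → ℤ)
    (hX : SignedConfig X w) (hcard : X.card = 2 * n) :
    visiblePairs X w + 4 ≤ 2 * (n * n) + 4 * n := by
  induction n using Nat.strong_induction_on generalizing X w with
  | _ n ih =>
    have htriv := visiblePairs_le hX
    rw [hcard] at htriv
    by_cases h3 : n ≤ 3
    · interval_cases n <;> omega
    have step : ∀ v : ℤ → ℤ, SignedConfig X v → HasRemovable X v →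
        visiblePairs X v + 4 ≤ 2 * (n * n) + 4 * n := by
      intro v hv hrem
      obtain ⟨m, rfl⟩ : ∃ m, n = m + 2 := ⟨n - 2, by omega⟩
      have hpair : ∀ a ∈ X, ∀ q ∈ X, q ≠ a → q ≠ -a →
          visiblePairs (X \ {a, -a, q, -q}) v + 4 ≤ 2 * (m * m) + 4 * m ∧
          (X \ {a, -a, q, -q}).card = 2 * m := by
        intro a ha q hq h1 h2
        have hc := hv.card_sdiff_pair_pair ha hq h1 h2
        exact ⟨ih m (by omega) (by omega) _ v (hv.sdiff_pair_pair a q) (by omega), by omega⟩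
      obtain ⟨a, ha, ⟨q, hq, h1, h2, h4⟩ | h4 | ⟨h5, q, hq, h1, h2, h4⟩⟩ := hrem
      · have e1 := visiblePairs_le_sdiff_pair_pair hv ha hq h1 h2
        have e2 := hpair a ha q hq h1 h2
        rw [e2.2] at e1
        nlinarith
      · have e1 := visiblePairs_le_sdiff_pair hv ha
        have hc := hv.card_sdiff_pair ha
        have e2 := ih (m + 1) (by omega) (by omega) _ v (hv.sdiff_pair a) (by omega)
        nlinarith
      -- Here `n = 4`. The cost 5 is affordable because the trivial bound for the remaining two
      -- orbits is 8, below the inductive 12: `8 + 16 + 20 = f 4`.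
      · have e1 := visiblePairs_le_sdiff_pair_pair hv ha hq h1 h2
        have e2 := (hpair a ha q hq h1 h2).2
        have e3 := visiblePairs_le (hv.sdiff_pair_pair a q)
        obtain rfl : m = 2 := by omega
        rw [e2] at e1 e3
        omega
    rcases hasRemovable_or_flip hX (by omega) with h | h
    · exact step w hX h
    · rw [← visiblePairs_flip]
      exact step _ hX.flip h

end Bound

/-! ### Degrees in the Hasse diagram: the upper bound and the extremal elements -/

section Degree

variable {n : ℕ}

theorem mem_signedIndexSet {x : ℤ} :
    x ∈ (Finset.Icc (-(n : ℤ)) (n : ℤ)).erase 0 ↔ x ≠ 0 ∧ -(n : ℤ) ≤ x ∧ x ≤ n := by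
  rw [Finset.mem_erase, Finset.mem_Icc]

theorem card_signedIndexSet : ((Finset.Icc (-(n : ℤ)) (n : ℤ)).erase 0).card = 2 * n := by
  rw [Finset.card_erase_of_mem (by rw [Finset.mem_Icc]; omega), Int.card_Icc]
  omega

theorem signedConfig_toIntFun (w : evenHyperoctahedralGroup n) :
    SignedConfig ((Finset.Icc (-(n : ℤ)) (n : ℤ)).erase 0) (toIntFun w) := by
  refine ⟨fun x hx => ?_, fun x hx => (mem_signedIndexSet.1 hx).1, fun x hx => ?_,
    fun x hx y hy h => ?_⟩
  · rw [mem_signedIndexSet] at hx ⊢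
    omega
  · have h1 := toIntFun_coe w ⟨x, hx⟩
    have h2 := toIntFun_coe w (-⟨x, hx⟩)
    rw [coe_apply_neg, SignedIndex.coe_neg] at h2
    rw [h2, ← h1]
  · have h1 := toIntFun_coe w ⟨x, hx⟩
    have h2 := toIntFun_coe w ⟨y, hy⟩
    exact (coe_apply_eq_iff w ⟨x, hx⟩ ⟨y, hy⟩).1 (by rw [← h1, ← h2]; exact h)

open Classical in
-- Exchange and antipode map the region `-j < i < j` onto four disjoint regions of ordered pairs,
-- each with equally many visible pairs.
theorem four_mul_card_le_visiblePairs {X : Finset ℤ} {w : ℤ → ℤ} (hX : SignedConfig X w) :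
    4 * ((X ×ˢ X).filter fun p : ℤ × ℤ => -p.2 < p.1 ∧ p.1 < p.2 ∧ Sees X w p.1 p.2).card ≤
      visiblePairs X w := by
  set V := (X ×ˢ X).filter fun p : ℤ × ℤ => Sees X w p.1 p.2 with hV
  have memV : ∀ p, p ∈ V ↔ (p.1 ∈ X ∧ p.2 ∈ X) ∧ Sees X w p.1 p.2 := by
    intro p
    rw [hV, Finset.mem_filter, Finset.mem_product]
  have hcard : visiblePairs X w = V.card := by
    unfold visiblePairs
    rw [hV, Finset.card_filter, Finset.sum_product]
    simp only [Finset.card_filter]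
  have key : ∀ (f : ℤ × ℤ → ℤ × ℤ), (∀ p, f (f p) = p) → (∀ p ∈ V, f p ∈ V) →
      ((X ×ˢ X).filter fun p : ℤ × ℤ => -p.2 < p.1 ∧ p.1 < p.2 ∧ Sees X w p.1 p.2).card =
        (V.filter fun p => -(f p).2 < (f p).1 ∧ (f p).1 < (f p).2).card := by
    intro f hf hfV
    have e : (X ×ˢ X).filter (fun p : ℤ × ℤ => -p.2 < p.1 ∧ p.1 < p.2 ∧ Sees X w p.1 p.2) =
        V.filter fun p => -p.2 < p.1 ∧ p.1 < p.2 := by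
      rw [hV, Finset.filter_filter]
      exact Finset.filter_congr fun p _ => by tauto
    rw [e]
    refine Finset.card_nbij' f f ?_ ?_ (fun p _ => hf p) (fun p _ => hf p)
    · intro p hp
      simp only [Finset.coe_filter, Set.mem_ofPred_eq] at hp ⊢
      rw [hf]
      exact ⟨hfV p hp.1, hp.2⟩
    · intro p hp
      simp only [Finset.coe_filter, Set.mem_ofPred_eq] at hp ⊢
      exact ⟨hfV p hp.1, hp.2⟩
  have k1 : _ = (V.filter fun p => -p.2 < p.1 ∧ p.1 < p.2).card :=
    key (fun p => p) (fun _ => rfl) (fun _ h => h)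
  have k2 : _ = (V.filter fun p => -p.1 < p.2 ∧ p.2 < p.1).card :=
    key (fun p => (p.2, p.1)) (fun _ => rfl) (fun p h => by
    rw [memV] at h ⊢
    exact ⟨⟨h.1.2, h.1.1⟩, h.2.symm⟩)
  have k3 : _ = (V.filter fun p => - -p.2 < -p.1 ∧ -p.1 < -p.2).card :=
    key (fun p => (-p.1, -p.2)) (fun p => by simp) (fun p h => by
    rw [memV] at h ⊢
    exact ⟨⟨hX.neg_mem _ h.1.1, hX.neg_mem _ h.1.2⟩, h.2.neg hX h.1.1 h.1.2⟩)
  have k4 : _ = (V.filter fun p => - -p.1 < -p.2 ∧ -p.2 < -p.1).card :=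
    key (fun p => (-p.2, -p.1)) (fun p => by simp) (fun p h => by
    rw [memV] at h ⊢
    exact ⟨⟨hX.neg_mem _ h.1.2, hX.neg_mem _ h.1.1⟩, (h.2.neg hX h.1.1 h.1.2).symm⟩)
  have hsum : (V.filter fun p => -p.2 < p.1 ∧ p.1 < p.2).card +
      (V.filter fun p => -p.1 < p.2 ∧ p.2 < p.1).card +
      (V.filter fun p => - -p.2 < -p.1 ∧ -p.1 < -p.2).card +
      (V.filter fun p => - -p.1 < -p.2 ∧ -p.2 < -p.1).card ≤ V.card := by
    simp only [Finset.card_filter]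
    rw [Finset.card_eq_sum_ones, ← Finset.sum_add_distrib, ← Finset.sum_add_distrib,
      ← Finset.sum_add_distrib]
    refine Finset.sum_le_sum fun p _ => ?_
    split_ifs <;> omega
  rw [hcard]
  omega

theorem hasseD_degree_le (hn : 3 ≤ n) (w : evenHyperoctahedralGroup n) :
    (hasseD n).degree w ≤ n ^ 2 / 2 + n - 1 := by
  have h1 := four_mul_card_le_visiblePairs (signedConfig_toIntFun w)
  have h2 := visiblePairs_bound n (by omega) _ _ (signedConfig_toIntFun w) card_signedIndexSet
  rw [← hasseD_degree hn w] at h1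
  rw [pow_two]
  omega

/-- An odd involution of `{±1, …, ±n}` with an even number of sign changes is in `D_n`. -/
theorem exists_of_involution (f : ℤ → ℤ)
    (hmem : ∀ x : ℤ, x ≠ 0 → -(n : ℤ) ≤ x → x ≤ n → f x ≠ 0 ∧ -(n : ℤ) ≤ f x ∧ f x ≤ n)
    (hodd : ∀ x, f (-x) = -f x)
    (hinv : ∀ x : ℤ, x ≠ 0 → -(n : ℤ) ≤ x → x ≤ n → f (f x) = x)
    (heven : Even ((Finset.Icc 1 (n : ℤ)).filter fun x => f x < 0).card) :
    ∃ π : evenHyperoctahedralGroup n, ∀ i, (π.1 i).1 = f i.1 := by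
  let F : SignedIndex n → SignedIndex n := fun i =>
    ⟨f i.1, mem_signedIndexSet.2 (hmem i.1 i.bounds.1 i.bounds.2.1 i.bounds.2.2)⟩
  have hF : Function.Involutive F := fun i =>
    Subtype.ext (hinv i.1 i.bounds.1 i.bounds.2.1 i.bounds.2.2)
  refine ⟨⟨hF.toPerm, fun a => Subtype.ext (hodd a.1), ?_⟩, fun i => rfl⟩
  have : (negSet hF.toPerm).card = ((Finset.Icc 1 (n : ℤ)).filter fun x => f x < 0).card := by
    refine Finset.card_bij (fun a _ => a.1) ?_ (fun a _ b _ h => Subtype.ext h) ?_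
    · intro a ha
      have hb := a.bounds
      simp only [negSet, Finset.mem_filter, Finset.mem_univ, true_and] at ha
      rw [Finset.mem_filter, Finset.mem_Icc]
      exact ⟨by omega, ha.2⟩
    · intro x hx
      rw [Finset.mem_filter, Finset.mem_Icc] at hx
      refine ⟨⟨x, mem_signedIndexSet.2 (by omega)⟩, ?_, rfl⟩
      simp only [negSet, Finset.mem_filter, Finset.mem_univ, true_and]
      exact ⟨by omega, hx.2⟩
  rwa [this]

theorem sees_of_eq (π : evenHyperoctahedralGroup n) {f : ℤ → ℤ} (hπ : ∀ i, (π.1 i).1 = f i.1)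
    {i j : ℤ} (hi : i ∈ (Finset.Icc (-(n : ℤ)) (n : ℤ)).erase 0)
    (hj : j ∈ (Finset.Icc (-(n : ℤ)) (n : ℤ)).erase 0)
    (h : Sees ((Finset.Icc (-(n : ℤ)) (n : ℤ)).erase 0) f i j) :
    Sees ((Finset.Icc (-(n : ℤ)) (n : ℤ)).erase 0) (toIntFun π) i j := by
  have e : ∀ k ∈ (Finset.Icc (-(n : ℤ)) (n : ℤ)).erase 0, toIntFun π k = f k := fun k hk => by
    rw [← hπ ⟨k, hk⟩, ← toIntFun_coe]
  refine ⟨h.1, h.2.1, fun k hk => ?_⟩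
  rw [e i hi, e j hj, e k hk]
  exact h.2.2 k hk

theorem card_le_degree (hn : 3 ≤ n) (π : evenHyperoctahedralGroup n) {f : ℤ → ℤ}
    (hπ : ∀ i, (π.1 i).1 = f i.1) (T : Finset (ℤ × ℤ))
    (hT : ∀ p ∈ T, p.1 ≠ 0 ∧ p.2 ≤ n ∧ -p.2 < p.1 ∧ p.1 < p.2 ∧
      Sees ((Finset.Icc (-(n : ℤ)) (n : ℤ)).erase 0) f p.1 p.2) :
    T.card ≤ (hasseD n).degree π := by
  classical
  rw [hasseD_degree hn]
  refine Finset.card_le_card fun p hp => ?_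
  obtain ⟨h0, h1, h2, h3, h4⟩ := hT p hp
  have m1 : p.1 ∈ (Finset.Icc (-(n : ℤ)) (n : ℤ)).erase 0 := mem_signedIndexSet.2 (by omega)
  have m2 : p.2 ∈ (Finset.Icc (-(n : ℤ)) (n : ℤ)).erase 0 := mem_signedIndexSet.2 (by omega)
  rw [Finset.mem_filter, Finset.mem_product]
  exact ⟨⟨m1, m2⟩, h2, h3, sees_of_eq π hπ m1 m2 h4⟩

/-- The window `[-1, -2, 3]` works: all six reflections give edges. The general extremal family
needs `m ≥ 2`. -/
theorem exists_six_le_degree : ∃ π : evenHyperoctahedralGroup 3, 6 ≤ (hasseD 3).degree π := by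
  let f : ℤ → ℤ := fun x => if x = 3 ∨ x = -3 then x else -x
  have hf : ∀ x, f x = if x = 3 ∨ x = -3 then x else -x := fun _ => rfl
  obtain ⟨π, hπ⟩ := exists_of_involution (n := 3) f
    (by intro x _ _ _; rw [hf]; push_cast at *; split_ifs <;> omega)
    (by intro x; simp only [hf]; split_ifs <;> omega)
    (by intro x _ _ _; simp only [hf]; split_ifs <;> omega)
    (by
      have : ((Finset.Icc 1 ((3 : ℕ) : ℤ)).filter fun x => f x < 0) = {1, 2} := by
        ext x
        simp only [Finset.mem_filter, Finset.mem_Icc, Finset.mem_insert, Finset.mem_singleton, hf]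
        push_cast
        split_ifs <;> omega
      rw [this]
      exact even_two)
  refine ⟨π, ?_⟩
  refine le_trans (by decide) (card_le_degree le_rfl π hπ
    {(1, 2), (-1, 2), (1, 3), (-1, 3), (2, 3), (-2, 3)} fun p hp => ?_)
  have hp' : (p.2 = 2 ∧ (p.1 = 1 ∨ p.1 = -1)) ∨
      (p.2 = 3 ∧ (p.1 = 1 ∨ p.1 = -1 ∨ p.1 = 2 ∨ p.1 = -2)) := by
    simp only [Finset.mem_insert, Finset.mem_singleton, Prod.ext_iff] at hp
    omega
  push_cast
  refine ⟨by omega, by omega, by omega, by omega, by omega, by omega, ?_⟩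
  intro k hk k1 k2 k3 k4 hb
  rw [Finset.mem_erase, Finset.mem_Icc] at hk
  unfold StrictlyBetween at hb
  simp only [hf] at hb
  split_ifs at hb <;> omega

/-- The extremal window `[ε, 2, …, m, -n, …, -(m + 1)]` as an odd function. -/
def extremalFun (n m ε x : ℤ) : ℤ :=
  if x = 1 then ε else if x = -1 then -ε else if -m ≤ x ∧ x ≤ m then x
  else if 0 < x then -(n + m + 1 - x) else n + m + 1 + x

/-- Positions between a low `i` and a high `j` have values outside the open interval from `w j` to
`w i`: low ones lie above `w i`, high ones below `w j`. The sign `ε` only affects `±1`, which are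
ignored or harmless. -/
theorem extremalFun_sees {m : ℕ} {ε : ℤ} (hε : ε = 1 ∨ ε = -1) (hm : 2 ≤ m) (hmn : m < n)
    {i j : ℤ} (hij : (i ≠ 0 ∧ -(m : ℤ) ≤ i ∧ i ≤ m ∧ m + 1 ≤ j ∧ j ≤ n) ∨
      (1 ≤ i ∧ j ≤ n ∧ i ≠ m ∧ j = i + 1) ∨ (i = -1 ∧ j = 2)) :
    Sees ((Finset.Icc (-(n : ℤ)) (n : ℤ)).erase 0) (extremalFun n m ε) i j := by
  have hv : ∀ k : ℤ, k ≠ 0 → (-(m : ℤ) ≤ k → k ≤ m →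
        (extremalFun n m ε k = k ∨ (k = 1 ∨ k = -1) ∧ extremalFun n m ε k = -k)) ∧
      (m < k → extremalFun n m ε k = -(n + m + 1 - k)) ∧
      (k < -m → extremalFun n m ε k = n + m + 1 + k) := by
    intro k hk
    unfold extremalFun
    split_ifs <;> omega
  refine ⟨by omega, by omega, fun k hk k1 k2 k3 k4 hb => ?_⟩
  rw [mem_signedIndexSet] at hk
  have vi := hv i (by omega)
  have vj := hv j (by omega)
  have vk := hv k hk.1
  generalize extremalFun n m ε i = y at *
  generalize extremalFun n m ε j = z at *
  generalize extremalFun n m ε k = t at *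
  clear hv
  unfold StrictlyBetween at hb
  rcases hij with hij | hij | hij
  · have vj' := vj.2.1 (by omega)
    have vi' := vi.1 (by omega) (by omega)
    clear vi vj
    omega
  · by_cases him : i < m
    · omega
    · have vj' := vj.2.1 (by omega)
      have vi' := vi.2.1 (by omega)
      clear vi vj
      omega
  · have vj' := vj.1 (by omega) (by omega)
    have vi' := vi.1 (by omega) (by omega)
    clear vi vj
    omega

theorem even_card_extremalFun_neg {m : ℕ} (hm : 2 ≤ m) (hmn : m < n) :
    Even ((Finset.Icc 1 (n : ℤ)).filter fun x => extremalFun n m ((-1) ^ (n - m)) x < 0).card := by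
  rcases Nat.even_or_odd (n - m) with h | h
  · have : ((Finset.Icc 1 (n : ℤ)).filter fun x => extremalFun n m ((-1) ^ (n - m)) x < 0) =
        Finset.Icc (m + 1 : ℤ) n := by
      rw [h.neg_one_pow]
      ext x
      rw [Finset.mem_filter, Finset.mem_Icc, Finset.mem_Icc]
      unfold extremalFun
      split_ifs <;> omega
    rw [this, Int.card_Icc]
    rwa [show ((n : ℤ) + 1 - (m + 1)).toNat = n - m by omega]
  · have : ((Finset.Icc 1 (n : ℤ)).filter fun x => extremalFun n m ((-1) ^ (n - m)) x < 0) =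
        insert 1 (Finset.Icc (m + 1 : ℤ) n) := by
      rw [h.neg_one_pow]
      ext x
      rw [Finset.mem_filter, Finset.mem_Icc, Finset.mem_insert, Finset.mem_Icc]
      unfold extremalFun
      split_ifs <;> omega
    rw [this, Finset.card_insert_of_notMem (by rw [Finset.mem_Icc]; omega), Int.card_Icc,
      show ((n : ℤ) + 1 - (m + 1)).toNat = n - m by omega]
    exact h.add_one

theorem exists_extremal {m : ℕ} (hm : 2 ≤ m) (hmn : m < n) (hn : 3 ≤ n) :
    ∃ π : evenHyperoctahedralGroup n,
      (∀ i, (π.1 i).1 = extremalFun n m ((-1) ^ (n - m)) i.1) ∧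
      2 * m * (n - m) + (n - 1) ≤ (hasseD n).degree π := by
  classical
  have hε : ((-1 : ℤ)) ^ (n - m) = 1 ∨ ((-1 : ℤ)) ^ (n - m) = -1 := neg_one_pow_eq_or ℤ _
  have heven := even_card_extremalFun_neg hm hmn
  obtain ⟨ε, hεe⟩ : ∃ ε : ℤ, (-1 : ℤ) ^ (n - m) = ε := ⟨_, rfl⟩
  rw [hεe] at hε heven ⊢
  obtain ⟨π, hπ⟩ := exists_of_involution (n := n) (extremalFun n m ε)
    (by intro x _ _ _; unfold extremalFun; split_ifs <;> omega)
    (by intro x; unfold extremalFun; split_ifs <;> omega)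
    (by
      intro x _ _ _
      obtain ⟨y, hy⟩ : ∃ y, extremalFun n m ε x = y := ⟨_, rfl⟩
      rw [hy]
      unfold extremalFun at hy ⊢
      split_ifs at hy ⊢ <;> omega)
    heven
  refine ⟨π, hπ, ?_⟩
  set A : Finset (ℤ × ℤ) := ((Finset.Icc (-(m : ℤ)) (m : ℤ)).erase 0) ×ˢ Finset.Icc (m + 1 : ℤ) n
    with hA
  -- The neighbours `m, m + 1` are omitted because `A` already contains them; `(-1, 2)` makes up for
  -- the loss.
  set B : Finset (ℤ × ℤ) := insert (-1, 2)
    (((Finset.Icc 1 (n - 1 : ℤ)).erase m).image fun i => (i, i + 1)) with hB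
  have memA : ∀ p, p ∈ A ↔ (p.1 ≠ 0 ∧ -(m : ℤ) ≤ p.1 ∧ p.1 ≤ m) ∧ (m + 1 ≤ p.2 ∧ p.2 ≤ n) := by
    intro p
    rw [hA, Finset.mem_product, mem_signedIndexSet, Finset.mem_Icc]
  have memB : ∀ p, p ∈ B → (1 ≤ p.1 ∧ p.2 ≤ n ∧ p.1 ≠ m ∧ p.2 = p.1 + 1) ∨
      (p.1 = -1 ∧ p.2 = 2) := by
    intro p hp
    rw [hB, Finset.mem_insert, Finset.mem_image] at hp
    rcases hp with rfl | ⟨i, hi, rfl⟩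
    · exact Or.inr ⟨rfl, rfl⟩
    · rw [Finset.mem_erase, Finset.mem_Icc] at hi
      exact Or.inl ⟨hi.2.1, by simp only; omega, hi.1, rfl⟩
  have hcA : A.card = 2 * m * (n - m) := by
    rw [hA, Finset.card_product, card_signedIndexSet, Int.card_Icc]
    congr 1
    omega
  have hcB : B.card = n - 1 := by
    rw [hB, Finset.card_insert_of_notMem, Finset.card_image_of_injective,
      Finset.card_erase_of_mem (by rw [Finset.mem_Icc]; omega), Int.card_Icc]
    · omega
    · intro i j h
      exact congrArg Prod.fst h
    · rw [Finset.mem_image]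
      rintro ⟨i, hi, h⟩
      rw [Prod.ext_iff] at h
      simp only at h
      omega
  have hdisj : Disjoint A B := by
    rw [Finset.disjoint_left]
    intro p hpA hpB
    rw [memA] at hpA
    have := memB p hpB
    omega
  rw [← hcA, ← hcB, ← Finset.card_union_of_disjoint hdisj]
  refine card_le_degree hn π hπ _ fun p hp => ?_
  have hp' : (p.1 ≠ 0 ∧ -(m : ℤ) ≤ p.1 ∧ p.1 ≤ m ∧ m + 1 ≤ p.2 ∧ p.2 ≤ n) ∨
      (1 ≤ p.1 ∧ p.2 ≤ n ∧ p.1 ≠ m ∧ p.2 = p.1 + 1) ∨ (p.1 = -1 ∧ p.2 = 2) := by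
    rcases Finset.mem_union.1 hp with h | h
    · rw [memA] at h
      omega
    · exact Or.inr (memB p h)
  exact ⟨by omega, by omega, by omega, by omega, extremalFun_sees hε hm hmn hp'⟩

theorem exists_window (hn : 4 ≤ n) : ∃ π : evenHyperoctahedralGroup n,
    (∀ i : SignedIndex n, 0 < i.1 →
      (π.1 i).1 =
        if i.1 = 1 then (-1) ^ (n - n / 2)
        else if i.1 ≤ ((n / 2 : ℕ) : ℤ) then i.1
        else -((n : ℤ) + ((n / 2 : ℕ) : ℤ) + 1 - i.1)) ∧
    (hasseD n).degree π = n ^ 2 / 2 + n - 1 := by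
  obtain ⟨π, hπ, hdeg⟩ := exists_extremal (n := n) (m := n / 2) (by omega) (by omega) (by omega)
  refine ⟨π, fun i hi => ?_, ?_⟩
  · rw [hπ]
    unfold extremalFun
    split_ifs <;> first | rfl | omega
  · refine le_antisymm (hasseD_degree_le (by omega) π) ?_
    have : 2 * (n / 2) * (n - n / 2) = n ^ 2 / 2 := by
      obtain ⟨k, rfl | rfl⟩ := Nat.even_or_odd' n
      · rw [show 2 * k / 2 = k by omega, show 2 * k - k = k by omega,
          show (2 * k) ^ 2 = 2 * (2 * k * k) by ring]
        omega
      · rw [show (2 * k + 1) / 2 = k by omega, show 2 * k + 1 - k = k + 1 by omega,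
          show (2 * k + 1) ^ 2 = 2 * (2 * k * (k + 1)) + 1 by ring]
        omega
    omega

end Degree

theorem theorem3p8 (n : ℕ) (hn : 3 ≤ n) :
    (hasseD n).maxDegree = n ^ 2 / 2 + n - 1 ∧
    (4 ≤ n → ∃ π : evenHyperoctahedralGroup n,
      (∀ i : SignedIndex n, 0 < i.1 →
        (π.1 i).1 =
          if i.1 = 1 then (-1) ^ (n - n / 2)
          else if i.1 ≤ ((n / 2 : ℕ) : ℤ) then i.1
          else -((n : ℤ) + ((n / 2 : ℕ) : ℤ) + 1 - i.1)) ∧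
      (hasseD n).degree π = n ^ 2 / 2 + n - 1) := by
  refine ⟨le_antisymm ((hasseD n).maxDegree_le_of_forall_degree_le _ (hasseD_degree_le hn)) ?_,
    exists_window⟩
  by_cases h4 : 4 ≤ n
  · obtain ⟨π, -, hπ⟩ := exists_window h4
    rw [← hπ]
    exact (hasseD n).degree_le_maxDegree π
  · obtain rfl : n = 3 := by omega
    obtain ⟨π, hπ⟩ := exists_six_le_degree
    exact hπ.trans ((hasseD 3).degree_le_maxDegree π)
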